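/- Let $V$ be the $5$-dimensional real vector space of symmetric real $3\times 3$ matrices $\sigma=(\sigma_{kl})$ with $\sigma_{22}=\sigma_{13}+\sigma_{31}$. Let $E_{kl}$ be the matrix units and let $$\sigma_1=2E_{11},\quad \sigma_2=E_{12}+E_{21},\quad \sigma_3=E_{13}+2E_{22}+E_{31},\quad \sigma_4=E_{23}+E_{32},\quad \sigma_5=2E_{33},$$ a basis of $V$. Let $W\subset\wedge^2 V$ be the subspace spanned by $$\sigma_1\wedge\sigma_4-\sigma_2\wedge\sigma_3,\qquad \sigma_1\wedge\sigma_5-\sigma_2\wedge\sigma_4,\qquad \sigma_2\wedge\sigma_5-\sigma_3\wedge\sigma_4 .$$ Let $\mathcal G=V\oplus(\wedge^2V)/W$ be the 2-step nilpotent Lie algebra with bracket $[(v,z),(v',z')]=(0,\ v\wedge v' \bmod W)$, and let $G$ be the simply connected Lie group with Lie algebra $\mathcal G$. The quotient $G/[G,G]$ is canonically identified with the vector space $V$. Every continuous automorphism $\tau$ of $G$ induces a linear automorphism $\overline\tau$ of $V=G/[G,G]$. (1) If $\tau$ is a continuous automorphism of $G$ such that $\det\overline\tau=1$, then there is a nonzero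 $v\in V$ with $\overline\tau(v)=v$. (2) Let $\Gamma$ be a lattice in $G$ (a discrete subgroup such that $G/\Gamma$ is compact), let $\tau$ be a continuous automorphism of $G$ with $\tau(\Gamma)=\Gamma$, and let $\pi(\tau):G/\Gamma\to G/\Gamma$, $g\Gamma\mapsto\tau(g)\Gamma$, be the factor of $\tau$. Then $\pi(\tau)$ is not an Anosov diffeomorphism of the compact manifold $G/\Gamma$, and it is not ergodic with respect to the $G$-invariant Borel probability measure on $G/\Gamma$. -/

import Mathlib

open MeasureTheory
open scoped Manifold ContDiff

noncomputable section

namespace TwoStep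

/-! ### The 2-step nilpotent Lie algebra and Lie group attached to `W ≤ ⋀² V` -/

section General

variable {V : Type} [AddCommGroup V] [Module ℝ V]

/-- The exterior product `v ∧ w`, an element of `⋀² V`, as a bilinear map. -/
def wedge : V →ₗ[ℝ] V →ₗ[ℝ] ⋀[ℝ]^2 V :=
  LinearMap.mk₂ ℝ (fun v w => exteriorPower.ιMulti ℝ 2 ![v, w])
    (fun v₁ v₂ w => by
      simpa using (exteriorPower.ιMulti ℝ 2 (M := V)).map_vecCons_add ![w] v₁ v₂)
    (fun c v w => by
      simpa using (exteriorPower.ιMulti ℝ 2 (M := V)).map_vecCons_smul ![w] c v)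
    (fun v w₁ w₂ => by
      have h := (exteriorPower.ιMulti ℝ 2 (M := V)).map_update_add ![v, 0] 1 w₁ w₂
      have e : ∀ w : V, Function.update ![v, 0] 1 w = ![v, w] := by
        intro w; ext i; fin_cases i <;> simp
      simpa only [e] using h)
    (fun c v w => by
      have h := (exteriorPower.ιMulti ℝ 2 (M := V)).map_update_smul ![v, 0] 1 c w
      have e : ∀ w : V, Function.update ![v, 0] 1 w = ![v, w] := by
        intro w; ext i; fin_cases i <;> simp
      simpa only [e] using h)

lemma wedge_apply (v w : V) : wedge v w = exteriorPower.ιMulti ℝ 2 ![v, w] := rfl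

lemma wedge_self (v : V) : wedge v v = 0 := by
  rw [wedge_apply]
  exact (exteriorPower.ιMulti ℝ 2 (M := V)).map_eq_zero_of_eq ![v, v]
    (i := 0) (j := 1) (by simp) (by decide)

lemma wedge_swap (v w : V) : wedge w v = -wedge v w := by
  have h := wedge_self (v + w)
  simp only [map_add, LinearMap.add_apply, wedge_self, zero_add, add_zero] at h
  exact eq_neg_of_add_eq_zero_left h

/-- The Lie algebra `V ⊕ (⋀² V)/W`. -/
def LieAlg (W : Submodule ℝ (⋀[ℝ]^2 V)) : Type := V × ((⋀[ℝ]^2 V) ⧸ W)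

variable (W : Submodule ℝ (⋀[ℝ]^2 V))

instance : AddCommGroup (LieAlg W) := inferInstanceAs (AddCommGroup (V × ((⋀[ℝ]^2 V) ⧸ W)))
instance : Module ℝ (LieAlg W) := inferInstanceAs (Module ℝ (V × ((⋀[ℝ]^2 V) ⧸ W)))
instance [Module.Finite ℝ V] : Module.Finite ℝ (LieAlg W) :=
  inferInstanceAs (Module.Finite ℝ (V × ((⋀[ℝ]^2 V) ⧸ W)))

/-- `[(v, z), (v', z')] = (0, v ∧ v' mod W)`, as a bilinear map. -/
def bracket : LieAlg W →ₗ[ℝ] LieAlg W →ₗ[ℝ] LieAlg W :=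
  ((wedge (V := V)).compr₂ (LinearMap.inr ℝ V _ ∘ₗ W.mkQ)).compl₁₂
    (LinearMap.fst ℝ V ((⋀[ℝ]^2 V) ⧸ W)) (LinearMap.fst ℝ V ((⋀[ℝ]^2 V) ⧸ W))

lemma bracket_apply (x y : LieAlg W) :
    bracket W x y = ((0 : V), W.mkQ (wedge x.1 y.1)) := rfl

lemma bracket_self (x : LieAlg W) : bracket W x x = 0 := by
  rw [bracket_apply, wedge_self, map_zero]; rfl

lemma bracket_bracket_left (x y z : LieAlg W) : bracket W (bracket W x y) z = 0 := by
  rw [bracket_apply W _ z, show (bracket W x y).1 = (0 : V) from rfl, map_zero,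
    LinearMap.zero_apply, map_zero]
  rfl

lemma bracket_bracket_right (x y z : LieAlg W) : bracket W x (bracket W y z) = 0 := by
  rw [bracket_apply W x, show (bracket W y z).1 = (0 : V) from rfl, map_zero, map_zero]
  rfl

instance : LieRing (LieAlg W) where
  bracket x y := bracket W x y
  add_lie x y z := by simp
  lie_add x y z := by simp
  lie_self x := bracket_self W x
  leibniz_lie x y z := by
    simp only [bracket_bracket_left, bracket_bracket_right, add_zero]

lemma lie_def (x y : LieAlg W) : ⁅x, y⁆ = bracket W x y := rfl

instance : LieAlgebra ℝ (LieAlg W) where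
  lie_smul c x y := by simp [lie_def]

/-- A norm on the finite-dimensional space `V ⊕ (⋀² V)/W` (the sup norm of coordinates);
only its topology, which does not depend on choices, matters below. -/
instance [Module.Finite ℝ V] : NormedAddCommGroup (LieAlg W) :=
  NormedAddCommGroup.induced (LieAlg W) (Fin (Module.finrank ℝ (LieAlg W)) → ℝ)
    (Module.finBasis ℝ (LieAlg W)).equivFun (LinearEquiv.injective _)

instance [Module.Finite ℝ V] : NormedSpace ℝ (LieAlg W) where
  norm_smul_le c x := by
    change ‖(Module.finBasis ℝ (LieAlg W)).equivFun (c • x)‖ ≤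
      ‖c‖ * ‖(Module.finBasis ℝ (LieAlg W)).equivFun x‖
    rw [map_smul, norm_smul]

/-- The simply connected Lie group with Lie algebra `V ⊕ (⋀² V)/W`, in exponential coordinates:
the underlying manifold is the Lie algebra, and the product is given by the
Baker–Campbell–Hausdorff formula, which for a 2-step nilpotent Lie algebra is
`x * y = x + y + [x, y] / 2`. -/
def NilGroup : Type := LieAlg W

variable {W}

/-- The exponential map, which is the identity in exponential coordinates. -/
def exp : LieAlg W ≃ NilGroup W := Equiv.refl _

/-- The inverse of the exponential map. -/
def log : NilGroup W ≃ LieAlg W := Equiv.refl _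

variable (W)

instance : Mul (NilGroup W) where
  mul x y := exp (log x + log y + (1 / 2 : ℝ) • ⁅log x, log y⁆)

instance : One (NilGroup W) where
  one := exp 0

instance : Inv (NilGroup W) where
  inv x := exp (-log x)

variable {W} in
lemma log_mul (x y : NilGroup W) :
    log (x * y) = log x + log y + (1 / 2 : ℝ) • ⁅log x, log y⁆ := rfl

variable {W} in
lemma log_inv (x : NilGroup W) : log x⁻¹ = -log x := rfl

lemma log_one : log (1 : NilGroup W) = 0 := rfl

instance : Group (NilGroup W) where
  mul_assoc x y z := by
    apply log.injective
    simp only [log_mul, lie_def, map_add, LinearMap.add_apply, map_smul, LinearMap.smul_apply,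
      bracket_bracket_left, bracket_bracket_right, smul_zero, add_zero, smul_add]
    abel
  one_mul x := by
    apply log.injective
    simp [log_mul, log_one]
  mul_one x := by
    apply log.injective
    simp [log_mul, log_one]
  inv_mul_cancel x := by
    apply log.injective
    simp [log_mul, log_one, log_inv]

instance [Module.Finite ℝ V] : TopologicalSpace (NilGroup W) :=
  inferInstanceAs (TopologicalSpace (LieAlg W))

instance [Module.Finite ℝ V] : T2Space (NilGroup W) :=
  inferInstanceAs (T2Space (LieAlg W))

instance [Module.Finite ℝ V] : ChartedSpace (LieAlg W) (NilGroup W) :=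
  inferInstanceAs (ChartedSpace (LieAlg W) (LieAlg W))

instance [Module.Finite ℝ V] : IsManifold 𝓘(ℝ, LieAlg W) ∞ (NilGroup W) :=
  inferInstanceAs (IsManifold 𝓘(ℝ, LieAlg W) ∞ (LieAlg W))

lemma contDiff_bracket [Module.Finite ℝ V] :
    ContDiff ℝ ∞ (fun p : LieAlg W × LieAlg W => ⁅p.1, p.2⁆) :=
  ((LinearMap.toContinuousBilinearMap (bracket W)).isBoundedBilinearMap).contDiff

instance [Module.Finite ℝ V] : LieGroup 𝓘(ℝ, LieAlg W) ∞ (NilGroup W) where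
  contMDiff_mul := by
    have h : ContDiff ℝ ∞ (fun p : LieAlg W × LieAlg W =>
        p.1 + p.2 + (1 / 2 : ℝ) • ⁅p.1, p.2⁆) :=
      (contDiff_fst.add contDiff_snd).add ((contDiff_bracket W).const_smul _)
    have h' : ContMDiff (𝓘(ℝ, LieAlg W).prod 𝓘(ℝ, LieAlg W)) 𝓘(ℝ, LieAlg W) ∞
        (fun p : LieAlg W × LieAlg W => p.1 + p.2 + (1 / 2 : ℝ) • ⁅p.1, p.2⁆) :=
      h.contMDiff.comp (contMDiff_fst.prodMk_space contMDiff_snd)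
    exact h'
  contMDiff_inv := by
    have h : ContDiff ℝ ∞ (fun p : LieAlg W => -p) := contDiff_neg
    exact h.contMDiff

instance [Module.Finite ℝ V] : IsTopologicalGroup (NilGroup W) :=
  topologicalGroup_of_lieGroup 𝓘(ℝ, LieAlg W) ∞

/-! ### The quotient `V` of the group by its commutator subgroup -/

/-- The projection of the group onto `V`, a homomorphism. -/
def proj : NilGroup W →* Multiplicative V where
  toFun x := Multiplicative.ofAdd (log x).1
  map_one' := rfl
  map_mul' x y := by
    change Multiplicative.ofAdd ((log x).1 + (log y).1 + (1 / 2 : ℝ) • (0 : V)) = _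
    rw [smul_zero, add_zero]; rfl

lemma proj_surjective : Function.Surjective (proj W) := fun v =>
  ⟨exp ((Multiplicative.toAdd v, 0) : V × ((⋀[ℝ]^2 V) ⧸ W)), rfl⟩

open scoped commutatorElement in
variable {W} in
lemma log_commutatorElement (x y : NilGroup W) : log ⁅x, y⁆ = ⁅log x, log y⁆ := by
  have h : ⁅x, y⁆ = exp ⁅log x, log y⁆ := by
    rw [commutatorElement_def, mul_inv_eq_iff_eq_mul, mul_inv_eq_iff_eq_mul]
    apply log.injective
    have e : ∀ a : LieAlg W, log (exp a) = a := fun _ => rfl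
    simp only [log_mul, e, lie_def, map_add, LinearMap.add_apply, bracket_bracket_left, smul_zero,
      add_zero]
    have hs : bracket W (log y) (log x) = -bracket W (log x) (log y) := by
      rw [← lie_def, ← lie_def, lie_skew]
    rw [hs]
    module
  rw [h]; rfl

open scoped commutatorElement in
/-- The kernel of the projection onto `V` is `[G, G]`, so that it identifies `G/[G, G]`
with `V`. -/
theorem ker_proj : (proj W).ker = commutator (NilGroup W) := by
  apply le_antisymm
  · have key : ∀ u : ⋀[ℝ]^2 V, ∀ c : ℝ,
        (exp (((0 : V), W.mkQ (c • u)) : V × ((⋀[ℝ]^2 V) ⧸ W)) : NilGroup W) ∈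
          commutator (NilGroup W) := by
      intro u
      have hu : u ∈ Submodule.span ℝ (Set.range (exteriorPower.ιMulti ℝ 2 (M := V))) := by
        rw [exteriorPower.ιMulti_span]; trivial
      induction hu using Submodule.span_induction with
      | mem u h =>
        obtain ⟨v, rfl⟩ := h
        intro c
        let x : NilGroup W := exp ((c • v 0, 0) : V × ((⋀[ℝ]^2 V) ⧸ W))
        let y : NilGroup W := exp ((v 1, 0) : V × ((⋀[ℝ]^2 V) ⧸ W))
        have hxy : (exp (((0 : V), W.mkQ (c • exteriorPower.ιMulti ℝ 2 v)) :
            V × ((⋀[ℝ]^2 V) ⧸ W)) : NilGroup W) = ⁅x, y⁆ := by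
          apply log.injective
          rw [log_commutatorElement, lie_def, bracket_apply]
          have hv : ![v 0, v 1] = v := by ext i; fin_cases i <;> rfl
          have : wedge (c • v 0) (v 1) = c • exteriorPower.ιMulti ℝ 2 v := by
            rw [map_smul, LinearMap.smul_apply, wedge_apply, hv]
          change _ = ((0 : V), W.mkQ (wedge (c • v 0) (v 1)))
          rw [this]; rfl
        rw [hxy]
        exact Subgroup.commutator_mem_commutator (Subgroup.mem_top _) (Subgroup.mem_top _)
      | zero => intro c; rw [smul_zero, map_zero]; exact one_mem _
      | add a b _ _ ha hb =>
        intro c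
        have := mul_mem (ha c) (hb c)
        convert this using 1
        apply log.injective
        rw [log_mul, lie_def, bracket_apply]
        change ((0 : V), W.mkQ (c • (a + b))) = ((0 : V), W.mkQ (c • a)) +
          ((0 : V), W.mkQ (c • b)) + (1 / 2 : ℝ) • ((0 : V), W.mkQ (wedge (0 : V) (0 : V)))
        simp
      | smul r a _ ha => intro c; rw [smul_smul]; exact ha _
    intro x hx
    obtain ⟨u, hu⟩ := W.mkQ_surjective (log x).2
    have h1 : (log x).1 = (0 : V) := hx
    have := key u 1
    rw [one_smul, hu, ← h1] at this
    exact this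
  · exact Abelianization.commutator_subset_ker (proj W)

variable {W}

lemma proj_apply_eq [Module.Finite ℝ V] (τ : NilGroup W ≃ₜ* NilGroup W) {x y : NilGroup W}
    (h : proj W x = proj W y) : proj W (τ x) = proj W (τ y) := by
  have hx : x⁻¹ * y ∈ commutator (NilGroup W) := by
    rw [← ker_proj, MonoidHom.mem_ker, map_mul, map_inv, h, inv_mul_cancel]
  have h2 := Abelianization.commutator_subset_ker
    ((proj W).comp (τ.toMulEquiv : NilGroup W →* NilGroup W)) hx
  rw [MonoidHom.mem_ker, map_mul, map_inv, inv_mul_eq_one] at h2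
  exact h2

lemma log_apply_smul [Module.Finite ℝ V] (τ : NilGroup W ≃ₜ* NilGroup W) (c : ℝ)
    (X : LieAlg W) : log (τ (exp (c • X))) = c • log (τ (exp X)) := by
  let f : ℝ →+ LieAlg W :=
    { toFun := fun t => log (τ (exp (t • X)))
      map_zero' := by
        rw [zero_smul]
        change log (τ 1) = 0
        rw [map_one]; rfl
      map_add' := by
        have hm : ∀ s t : ℝ, (exp ((s + t) • X) : NilGroup W) = exp (s • X) * exp (t • X) := by
          intro s t
          apply log.injective
          rw [log_mul]
          change (s + t) • X = s • X + t • X + (1 / 2 : ℝ) • ⁅s • X, t • X⁆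
          simp [add_smul]
        have hl : ∀ s t : ℝ, log (τ (exp ((s + t) • X))) = log (τ (exp (s • X))) +
            log (τ (exp (t • X))) +
              (1 / 2 : ℝ) • ⁅log (τ (exp (s • X))), log (τ (exp (t • X)))⁆ := by
          intro s t
          rw [hm, map_mul, log_mul]
        intro s t
        have h1 := hl s t
        have h2 := hl t s
        rw [add_comm t s, h1, add_comm (log (τ (exp (t • X)))), add_right_inj,
          ← lie_skew, smul_neg, neg_eq_iff_add_eq_zero, ← two_smul ℝ, smul_smul] at h2
        rw [h1, ← lie_skew, smul_neg]
        norm_num at h2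
        rw [h2]
        simp }
  have hf : Continuous f := by
    have h1 : Continuous (fun t : ℝ => t • X) := by fun_prop
    exact τ.continuous.comp h1
  have := map_real_smul f hf c 1
  simpa [f] using this

/-- The factor on `V = G/[G, G]` of a continuous automorphism `τ` of `G`; it is characterized
by `factor_proj`. -/
def factor [Module.Finite ℝ V] (τ : NilGroup W ≃ₜ* NilGroup W) : V →ₗ[ℝ] V where
  toFun v := (proj W (τ (exp ((v, 0) : V × ((⋀[ℝ]^2 V) ⧸ W))))).toAdd
  map_add' v w := by
    rw [← toAdd_mul, ← map_mul, ← map_mul]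
    congr 1
    apply proj_apply_eq
    rw [map_mul]; rfl
  map_smul' c v := by
    have h := log_apply_smul τ c ((v, 0) : V × ((⋀[ℝ]^2 V) ⧸ W))
    have e : (exp ((c • v, 0) : V × ((⋀[ℝ]^2 V) ⧸ W)) : NilGroup W) =
        exp (c • (((v, 0) : V × ((⋀[ℝ]^2 V) ⧸ W)) : LieAlg W)) := by
      congr 1
      change _ = (c • v, c • (0 : (⋀[ℝ]^2 V) ⧸ W))
      rw [smul_zero]
    rw [e]
    exact congrArg Prod.fst h

theorem factor_proj [Module.Finite ℝ V] (τ : NilGroup W ≃ₜ* NilGroup W) (x : NilGroup W) :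
    factor τ (proj W x).toAdd = (proj W (τ x)).toAdd := by
  change (proj W (τ _)).toAdd = _
  congr 1
  exact proj_apply_eq τ rfl

/-! ### Nilmanifolds `G/Γ` -/

section Quotient

variable [Module.Finite ℝ V] (Γ : Subgroup (NilGroup W))

lemma isLocalHomeomorph_mk [DiscreteTopology Γ] :
    IsLocalHomeomorph (QuotientGroup.mk : NilGroup W → NilGroup W ⧸ Γ) :=
  (Γ.isQuotientCoveringMap ⟨inferInstance⟩).isCoveringMap.isLocalHomeomorph

/-- The manifold structure on `G/Γ`, `Γ` discrete: charts are local inverses of `G → G/Γ`. -/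
instance [DiscreteTopology Γ] : ChartedSpace (LieAlg W) (NilGroup W ⧸ Γ) :=
  (isLocalHomeomorph_mk Γ).chartedSpaceOfRightInverse (g := Quotient.out)
    (fun q => Quotient.out_eq q)

instance [DiscreteTopology Γ] : IsManifold 𝓘(ℝ, LieAlg W) ∞ (NilGroup W ⧸ Γ) := by
  apply isManifold_of_contDiffOn
  rintro _ _ ⟨p, rfl⟩ ⟨q, rfl⟩
  have hloc := isLocalHomeomorph_mk Γ
  set a := hloc.localInverseAt (Quotient.out p) with ha
  set b := hloc.localInverseAt (Quotient.out q) with hb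
  let mk : NilGroup W → NilGroup W ⧸ Γ := QuotientGroup.mk
  -- the transition map sends `u` to `b (uΓ)`, which locally is a right translation
  let φ : LieAlg W → LieAlg W := fun u => log (b (mk (exp u)))
  have hsymm : ∀ u : NilGroup W, a.symm u = mk u :=
    fun u => congrFun (hloc.localInverseAt_symm _) u
  have hsource : ∀ u : LieAlg W,
      u ∈ ((a.trans (chartAt (LieAlg W) (Quotient.out p))).symm.trans
        (b.trans (chartAt (LieAlg W) (Quotient.out q)))).source → mk (exp u) ∈ b.source := by
    intro u hu
    have h2 : a.symm (exp u) ∈ b.source := hu.2.1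
    rwa [hsymm] at h2
  have hopen : IsOpen ((a.trans (chartAt (LieAlg W) (Quotient.out p))).symm.trans
        (b.trans (chartAt (LieAlg W) (Quotient.out q)))).source :=
    OpenPartialHomeomorph.open_source _
  set O := ((a.trans (chartAt (LieAlg W) (Quotient.out p))).symm.trans
        (b.trans (chartAt (LieAlg W) (Quotient.out q)))).source with hO
  have hφ : ContDiffOn ℝ ∞ φ O := by
    intro u₀ hu₀
    let g : NilGroup W → NilGroup W := fun u => u⁻¹ * b (mk u)
    have hg : ∀ u ∈ O, g (exp u) ∈ Γ := by
      intro u hu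
      have h3 : mk (b (mk (exp u))) = mk (exp u) :=
        hloc.apply_localInverseAt_of_mem (hsource u hu)
      exact QuotientGroup.eq.1 h3.symm
    have hgc : ContinuousAt g (exp u₀) := by
      have h4 : ContinuousAt b (mk (exp u₀)) := b.continuousAt (hsource u₀ hu₀)
      have h5 : ContinuousAt mk (exp u₀) := QuotientGroup.continuous_mk.continuousAt
      exact continuousAt_id.inv.mul (h4.comp h5)
    obtain ⟨N, hN, hNΓ⟩ : ∃ N ∈ nhds (g (exp u₀)), ∀ x ∈ N, x ∈ Γ → x = g (exp u₀) := by
      have h6 : IsDiscrete (Γ : Set (NilGroup W)) := ⟨inferInstance⟩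
      obtain ⟨N, hN, hN'⟩ :=
        isDiscrete_iff_forall_mem_exists_isOpen.1 h6 (g (exp u₀)) (hg u₀ hu₀)
      have h7 : g (exp u₀) ∈ N ∩ Γ := hN' ▸ Set.mem_singleton _
      refine ⟨N, hN.mem_nhds h7.1, fun x hx hx' => ?_⟩
      have h8 : x ∈ N ∩ (Γ : Set (NilGroup W)) := ⟨hx, hx'⟩
      rwa [hN'] at h8
    have h8 : ∀ᶠ u in nhds u₀, φ u = log (exp u * g (exp u₀)) := by
      have h9 : ∀ᶠ u in nhds u₀, g (exp u) ∈ N := hgc hN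
      filter_upwards [h9, hopen.mem_nhds hu₀] with u h10 h11
      rw [← hNΓ _ h10 (hg u h11)]
      simp only [g, mul_inv_cancel_left, φ]
    have h12 : ContDiff ℝ ∞ (fun u : LieAlg W => log (exp u * g (exp u₀))) :=
      (contMDiff_mul_right (I := 𝓘(ℝ, LieAlg W)) (n := ∞) (a := g (exp u₀))).contDiff
    exact (h12.contDiffAt.congr_of_eventuallyEq h8).contDiffWithinAt
  refine hφ.congr_mono ?_ ?_
  · intro u _
    exact congrArg b (hsymm (exp u))
  · intro u hu
    exact hu.1

instance : MeasurableSpace (NilGroup W ⧸ Γ) := borel _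

instance : BorelSpace (NilGroup W ⧸ Γ) := ⟨rfl⟩

variable {Γ} in
/-- The factor `gΓ ↦ τ(g)Γ` on `G/Γ` of an automorphism `τ` of `G` with `τ(Γ) = Γ`. -/
def quotientMap (τ : NilGroup W ≃ₜ* NilGroup W) (hτ : τ '' (Γ : Set (NilGroup W)) = Γ) :
    NilGroup W ⧸ Γ → NilGroup W ⧸ Γ :=
  Quotient.map' τ fun x y h => by
    rw [QuotientGroup.leftRel_apply] at h ⊢
    rw [← map_inv, ← map_mul, ← SetLike.mem_coe, ← hτ]
    exact Set.mem_image_of_mem τ h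

end Quotient

end General

/-! ### The pair `V`, `W` -/

/-- The space `V` of symmetric real `3 × 3` matrices `σ` with `σ₂₂ = σ₁₃ + σ₃₁`
(matrix indices `1, 2, 3` are written `0, 1, 2`). -/
def V : Submodule ℝ (Matrix (Fin 3) (Fin 3) ℝ) where
  carrier := {σ | σ.IsSymm ∧ σ 1 1 = σ 0 2 + σ 2 0}
  add_mem' {a b} ha hb := ⟨ha.1.add hb.1, by
    simp only [Matrix.add_apply, ha.2, hb.2]; ring⟩
  zero_mem' := ⟨Matrix.isSymm_zero, by simp⟩
  smul_mem' c a ha := ⟨ha.1.smul c, by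
    simp only [Matrix.smul_apply, smul_eq_mul, ha.2]; ring⟩

/-- `σ₁ = 2 E₁₁`. -/
def σ₁ : V := ⟨!![2, 0, 0; 0, 0, 0; 0, 0, 0], by
  refine ⟨?_, by simp⟩; ext i j; fin_cases i <;> fin_cases j <;> rfl⟩

/-- `σ₂ = E₁₂ + E₂₁`. -/
def σ₂ : V := ⟨!![0, 1, 0; 1, 0, 0; 0, 0, 0], by
  refine ⟨?_, by simp⟩; ext i j; fin_cases i <;> fin_cases j <;> rfl⟩

/-- `σ₃ = E₁₃ + 2 E₂₂ + E₃₁`. -/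
def σ₃ : V := ⟨!![0, 0, 1; 0, 2, 0; 1, 0, 0], by
  refine ⟨?_, show (2 : ℝ) = 1 + 1 by norm_num⟩; ext i j; fin_cases i <;> fin_cases j <;> rfl⟩

/-- `σ₄ = E₂₃ + E₃₂`. -/
def σ₄ : V := ⟨!![0, 0, 0; 0, 0, 1; 0, 1, 0], by
  refine ⟨?_, by simp⟩; ext i j; fin_cases i <;> fin_cases j <;> rfl⟩

/-- `σ₅ = 2 E₃₃`. -/
def σ₅ : V := ⟨!![0, 0, 0; 0, 0, 0; 0, 0, 2], by
  refine ⟨?_, by simp⟩; ext i j; fin_cases i <;> fin_cases j <;> rfl⟩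

/-- The three-dimensional subspace `W` of `⋀² V`. -/
def W : Submodule ℝ (⋀[ℝ]^2 V) :=
  Submodule.span ℝ {wedge σ₁ σ₄ - wedge σ₂ σ₃, wedge σ₁ σ₅ - wedge σ₂ σ₄,
    wedge σ₂ σ₅ - wedge σ₃ σ₄}

/-- The 2-step simply connected nilpotent Lie group attached to `V` and `W`. -/
abbrev G : Type := NilGroup W

end TwoStep

/-- A self-map `f` of a `C¹` manifold `M` (used for compact `M`) is an Anosov diffeomorphism if it
is a `C¹` diffeomorphism and, for a continuous Riemannian metric on `M`, the tangent spaces split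
as `E^s ⊕ E^u` so that the splitting is invariant under the derivative `Df`, and, with constants
`C > 0` and `0 < r < 1`, `‖Dfⁿ v‖ ≤ C rⁿ ‖v‖` for `v ∈ E^s` and `‖v‖ ≤ C rⁿ ‖Dfⁿ v‖` for
`v ∈ E^u`, for all `n ≥ 0`. (The continuity of such a splitting is automatic.) -/
def IsAnosovDiffeomorph {E : Type*} [NormedAddCommGroup E] [NormedSpace ℝ E]
    {H : Type*} [TopologicalSpace H] (I : ModelWithCorners ℝ E H)
    {M : Type*} [TopologicalSpace M] [ChartedSpace H M] [IsManifold I 1 M] (f : M → M) : Prop :=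
  (∃ Φ : M ≃ₘ^1⟮I, I⟯ M, ⇑Φ = f) ∧
  ∃ (g : Bundle.ContinuousRiemannianMetric E (fun x : M => TangentSpace I x))
    (Es Eu : ∀ x : M, Submodule ℝ (TangentSpace I x)) (C r : ℝ),
    0 < C ∧ 0 < r ∧ r < 1 ∧
    ∀ x : M, IsCompl (Es x) (Eu x) ∧
      (Es x).map (mfderiv I I f x : TangentSpace I x →ₗ[ℝ] TangentSpace I (f x)) = Es (f x) ∧
      (Eu x).map (mfderiv I I f x : TangentSpace I x →ₗ[ℝ] TangentSpace I (f x)) = Eu (f x) ∧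
      (∀ v ∈ Es x, ∀ n : ℕ,
        √(g.inner (f^[n] x) (mfderiv I I f^[n] x v) (mfderiv I I f^[n] x v)) ≤
          C * r ^ n * √(g.inner x v v)) ∧
      (∀ v ∈ Eu x, ∀ n : ℕ,
        √(g.inner x v v) ≤
          C * r ^ n * √(g.inner (f^[n] x) (mfderiv I I f^[n] x v) (mfderiv I I f^[n] x v)))

end

/-! Part (1). An automorphism acts on V by a matrix g which preserves W, seen as a three-dimensional
space of skew 5×5 matrices S(x): g S(x) gᵀ = S(xh) for some 3×3 matrix h. The order four Pfaffians
of S(x) form a vector P(x), quadratic in x, and if det g = 1 then gᵀ P(xh) = P(x)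
(`pfaffianPolar_skewPencil_congr`). The polarization Sym² ℝ³ → ℝ⁵ of P has kernel spanned by e₁² −
2e₀e₂, so h is a similitude of q = x₁² − 2x₀x₂, with multiplier c > 0. The form 3q(x,y)² − q(x)q(y)
descends to a nondegenerate form on ℝ⁵; determinants there give c¹⁰ = 1, so c = 1. Now h is
orthogonal for q in odd dimension, so det h = ±1 is an eigenvalue of h. For an eigenvector x the
sign is lost in P(xh), and P(x) ≠ 0 is fixed by gᵀ; hence 1 is an eigenvalue of g
(`det_sub_one_eq_zero_of_skewPencil`).

Part (2). The image of Γ in V is a lattice preserved by the factor of τ, whose determinant is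
therefore ±1 (`det_factor_sq_eq_one`). Part (1), applied to τ², gives a nonzero v ∈ V fixed by the
square of the factor. By integrality some nonzero linear form, integral on the lattice, is also
fixed, and its character produces a nonconstant continuous invariant function
(`not_ergodic_quotientMap`). On the Lie algebra, τ² has the eigenvalue 1 as well, which contradicts
hyperbolicity at the fixed point Γ of the factor of τ (`not_isAnosovDiffeomorph_quotientMap`). -/

noncomputable section

namespace TwoStep

/-! ### The pencil of skew matrices and its Pfaffians -/

section MatrixPencil

open Matrix

/-- The Pfaffian of the skew form `w` with upper triangular entries `a`, evaluated on four
vectors, expands in the maximal minors of the vectors and the Pfaffians of order four of `a`. -/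
lemma pfaffian_congr (r : Fin 4 → Fin 5 → ℝ) (a : Fin 10 → ℝ)
    (w : (Fin 5 → ℝ) → (Fin 5 → ℝ) → ℝ)
    (hw : ∀ u v, w u v = a 0 * (u 0 * v 1 - u 1 * v 0) + a 1 * (u 0 * v 2 - u 2 * v 0) +
      a 2 * (u 0 * v 3 - u 3 * v 0) + a 3 * (u 0 * v 4 - u 4 * v 0) +
      a 4 * (u 1 * v 2 - u 2 * v 1) + a 5 * (u 1 * v 3 - u 3 * v 1) +
      a 6 * (u 1 * v 4 - u 4 * v 1) + a 7 * (u 2 * v 3 - u 3 * v 2) +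
      a 8 * (u 2 * v 4 - u 4 * v 2) + a 9 * (u 3 * v 4 - u 4 * v 3)) :
    w (r 0) (r 1) * w (r 2) (r 3) - w (r 0) (r 2) * w (r 1) (r 3) +
      w (r 0) (r 3) * w (r 1) (r 2) =
    (Matrix.of fun i j => r i ((0 : Fin 5).succAbove j)).det * (a 4 * a 9 - a 5 * a 8 + a 6 * a 7) +
    (Matrix.of fun i j => r i ((1 : Fin 5).succAbove j)).det * (a 1 * a 9 - a 2 * a 8 + a 3 * a 7) +
    (Matrix.of fun i j => r i ((2 : Fin 5).succAbove j)).det * (a 0 * a 9 - a 2 * a 6 + a 3 * a 5) +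
    (Matrix.of fun i j => r i ((3 : Fin 5).succAbove j)).det * (a 0 * a 8 - a 1 * a 6 + a 3 * a 4) +
    (Matrix.of fun i j => r i ((4 : Fin 5).succAbove j)).det *
      (a 0 * a 7 - a 1 * a 5 + a 2 * a 4) := by
  have h0 : (0 : Fin 5).succAbove = ![1, 2, 3, 4] := by decide
  have h1 : (1 : Fin 5).succAbove = ![0, 2, 3, 4] := by decide
  have h2 : (2 : Fin 5).succAbove = ![0, 1, 3, 4] := by decide
  have h3 : (3 : Fin 5).succAbove = ![0, 1, 2, 4] := by decide
  have h4 : (4 : Fin 5).succAbove = ![0, 1, 2, 3] := by decide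
  have hd : ∀ M : Matrix (Fin 4) (Fin 4) ℝ, M.det =
      M 0 0 * (M 1 1 * (M 2 2 * M 3 3 - M 2 3 * M 3 2) - M 1 2 * (M 2 1 * M 3 3 - M 2 3 * M 3 1)
        + M 1 3 * (M 2 1 * M 3 2 - M 2 2 * M 3 1))
      - M 0 1 * (M 1 0 * (M 2 2 * M 3 3 - M 2 3 * M 3 2) - M 1 2 * (M 2 0 * M 3 3 - M 2 3 * M 3 0)
        + M 1 3 * (M 2 0 * M 3 2 - M 2 2 * M 3 0))
      + M 0 2 * (M 1 0 * (M 2 1 * M 3 3 - M 2 3 * M 3 1) - M 1 1 * (M 2 0 * M 3 3 - M 2 3 * M 3 0)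
        + M 1 3 * (M 2 0 * M 3 1 - M 2 1 * M 3 0))
      - M 0 3 * (M 1 0 * (M 2 1 * M 3 2 - M 2 2 * M 3 1) - M 1 1 * (M 2 0 * M 3 2 - M 2 2 * M 3 0)
        + M 1 2 * (M 2 0 * M 3 1 - M 2 1 * M 3 0)) := by
    intro M
    rw [Matrix.det_succ_row_zero]
    simp only [Matrix.det_fin_three, Fin.sum_univ_four, Matrix.submatrix_apply]
    have e0 : (0 : Fin 4).succAbove = ![1, 2, 3] := by decide
    have e1 : (1 : Fin 4).succAbove = ![0, 2, 3] := by decide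
    have e2 : (2 : Fin 4).succAbove = ![0, 1, 3] := by decide
    have e3 : (3 : Fin 4).succAbove = ![0, 1, 2] := by decide
    have s0 : (0 : Fin 3).succ = (1 : Fin 4) := rfl
    have s1 : (1 : Fin 3).succ = (2 : Fin 4) := rfl
    have s2 : (2 : Fin 3).succ = (3 : Fin 4) := rfl
    simp only [e0, e1, e2, e3, s0, s1, s2, Matrix.cons_val]
    norm_num
    ring
  simp only [hw, hd, Matrix.of_apply, h0, h1, h2, h3, h4, Matrix.cons_val]
  ring

/-- The pencil of skew matrices spanned by the generators of `W`. -/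
def skewPencil (x : Fin 3 → ℝ) : Matrix (Fin 5) (Fin 5) ℝ :=
  !![0, 0, 0, x 0, x 1;
    0, 0, -x 0, -x 1, x 2;
    0, x 0, 0, -x 2, 0;
    -x 0, x 1, x 2, 0, 0;
    -x 1, -x 2, 0, 0, 0]

/-- The polarization of the map sending `x` to the vector of order four Pfaffians of
`skewPencil x`. -/
def pfaffianPolar (x y : Fin 3 → ℝ) : Fin 5 → ℝ :=
  -- For y = x, entry k is −(−1)ᵏ times the Pfaffian left after deleting row and column k. With
  -- these signs, minors of a congruence become cofactors.
  ![x 2 * y 2, -(x 1 * y 2 + x 2 * y 1) / 2, x 1 * y 1 + (x 0 * y 2 + x 2 * y 0) / 2,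
    -(x 0 * y 1 + x 1 * y 0) / 2, x 0 * y 0]

/-- Each Pfaffian of g S(x) gᵀ expands in the Pfaffians of S(x), with the 4×4 minors of g as
coefficients. With the signs built into `pfaffianPolar`, these minors are the entries of the
adjugate. -/
lemma pfaffianPolar_skewPencil_congr {g : Matrix (Fin 5) (Fin 5) ℝ} {x y : Fin 3 → ℝ}
    (h : g * skewPencil x * gᵀ = skewPencil y) :
    pfaffianPolar y y = (adjugate g)ᵀ *ᵥ pfaffianPolar x x := by
  -- The entries of `skewPencil x` above the diagonal, row by row.
  let a : Fin 10 → ℝ := ![0, 0, x 0, x 1, -x 0, -x 1, x 2, -x 2, 0, 0]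
  let w : (Fin 5 → ℝ) → (Fin 5 → ℝ) → ℝ := fun u v => u ⬝ᵥ (skewPencil x *ᵥ v)
  have hw : ∀ u v, w u v = a 0 * (u 0 * v 1 - u 1 * v 0) + a 1 * (u 0 * v 2 - u 2 * v 0) +
      a 2 * (u 0 * v 3 - u 3 * v 0) + a 3 * (u 0 * v 4 - u 4 * v 0) +
      a 4 * (u 1 * v 2 - u 2 * v 1) + a 5 * (u 1 * v 3 - u 3 * v 1) +
      a 6 * (u 1 * v 4 - u 4 * v 1) + a 7 * (u 2 * v 3 - u 3 * v 2) +
      a 8 * (u 2 * v 4 - u 4 * v 2) + a 9 * (u 3 * v 4 - u 4 * v 3) := by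
    intro u v
    simp [w, a, skewPencil, dotProduct, mulVec, Fin.sum_univ_five]
    ring
  have hg : ∀ i j, w (g i) (g j) = skewPencil y i j := by
    intro i j
    rw [← h, Matrix.mul_assoc]
    simp only [w, Matrix.mul_apply, dotProduct, mulVec, Matrix.transpose_apply]
  obtain ⟨m, hm⟩ : ∃ m : Fin 5 → Fin 5 → ℝ, ∀ i j,
      (Matrix.of fun k l => g (i.succAbove k) (j.succAbove l)).det = m i j := ⟨_, fun _ _ => rfl⟩
  -- The four vectors are the rows of g other than row k, so the left side is the Pfaffian of
  -- `skewPencil y` with row and column k deleted.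
  have key := fun k : Fin 5 => pfaffian_congr (fun i => g (k.succAbove i)) a w hw
  have hadj : ∀ i j, adjugate g j i = (-1) ^ (i + j : ℕ) * m i j := by
    intro i j
    rw [adjugate_fin_succ_eq_det_submatrix, ← hm]
    rfl
  simp only [hg, hm] at key
  have h1 : (1 : Fin 5).succAbove = ![0, 2, 3, 4] := by decide
  have h2 : (2 : Fin 5).succAbove = ![0, 1, 3, 4] := by decide
  have h3 : (3 : Fin 5).succAbove = ![0, 1, 2, 4] := by decide
  have h4 : (4 : Fin 5).succAbove = ![0, 1, 2, 3] := by decide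
  have k0 := key 0
  have k1 := key 1
  have k2 := key 2
  have k3 := key 3
  have k4 := key 4
  simp [skewPencil, a] at k0
  simp [h1, skewPencil, a] at k1
  simp [h2, skewPencil, a] at k2
  simp [h3, skewPencil, a] at k3
  simp [h4, skewPencil, a] at k4
  funext i
  fin_cases i <;> simp [mulVec, dotProduct, Fin.sum_univ_five, hadj, pfaffianPolar]
  · linear_combination -k0
  · linear_combination k1
  · linear_combination -k2
  · linear_combination k3
  · linear_combination -k4

lemma pfaffianPolar_self_eq_zero {x : Fin 3 → ℝ} (hx : pfaffianPolar x x = 0) : x = 0 := by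
  have h0 := congrFun hx 4
  have h1 := congrFun hx 2
  have h2 := congrFun hx 0
  simp [pfaffianPolar] at h0 h1 h2
  simp [h0, h2] at h1
  funext i
  fin_cases i <;> simp [h0, h1, h2]

/-- The vectors P(x) span ℝ⁵: the five values of x used here already give a basis. -/
lemma eq_zero_of_forall_pfaffianPolar_dotProduct {m : Fin 5 → ℝ}
    (hm : ∀ x, pfaffianPolar x x ⬝ᵥ m = 0) : m = 0 := by
  have h1 := hm ![1, 0, 0]
  have h2 := hm ![0, 1, 0]
  have h3 := hm ![0, 0, 1]
  have h4 := hm ![1, 1, 0]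
  have h5 := hm ![0, 1, 1]
  simp [pfaffianPolar, dotProduct, Fin.sum_univ_five] at h1 h2 h3 h4 h5
  rw [h1, h2] at h4
  rw [h2, h3] at h5
  funext i
  fin_cases i <;> simp <;> linarith

/-- A matrix of determinant one which preserves the pencil of skew matrices has the
eigenvalue `1`. -/
theorem det_sub_one_eq_zero_of_skewPencil {g : Matrix (Fin 5) (Fin 5) ℝ} (hg : g.det = 1)
    {h : Matrix (Fin 3) (Fin 3) ℝ}
    (hgh : ∀ x, g * skewPencil x * gᵀ = skewPencil (x ᵥ* h)) : (g - 1).det = 0 := by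
  have diag : ∀ x, gᵀ *ᵥ pfaffianPolar (x ᵥ* h) (x ᵥ* h) = pfaffianPolar x x := by
    intro x
    rw [pfaffianPolar_skewPencil_congr (hgh x), mulVec_mulVec, ← transpose_mul, adjugate_mul, hg,
      one_smul, transpose_one, one_mulVec]
  have expand : ∀ x y, pfaffianPolar (x + y) (x + y) =
      pfaffianPolar x x + pfaffianPolar y y + (2 : ℝ) • pfaffianPolar x y := by
    intro x y
    funext i
    fin_cases i <;> simp [pfaffianPolar] <;> ring
  have polar : ∀ x y, gᵀ *ᵥ pfaffianPolar (x ᵥ* h) (y ᵥ* h) = pfaffianPolar x y := by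
    intro x y
    have h1 := diag (x + y)
    rw [add_vecMul, expand, expand, mulVec_add, mulVec_add, diag, diag, add_right_inj,
      mulVec_smul] at h1
    exact smul_right_injective _ (two_ne_zero' ℝ) h1
  have hginv : ∀ u, gᵀ *ᵥ u = 0 → u = 0 := by
    intro u hu
    by_contra hne
    have := exists_mulVec_eq_zero_iff.1 ⟨u, hne, hu⟩
    rw [det_transpose, hg] at this
    exact one_ne_zero this
  -- `h` is a similitude of the quadratic form `q`
  let q : Matrix (Fin 3) (Fin 3) ℝ := !![0, 0, -1; 0, 1, 0; -1, 0, 0]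
  have hqq : q * q = 1 := by
    ext i j
    fin_cases i <;> fin_cases j <;> simp [q, Matrix.mul_apply, Fin.sum_univ_three]
  have hqdet : q.det = -1 := by simp [q, det_fin_three]
  -- The tensor e₁² − 2e₀e₂, whose Gram matrix is `q`, is killed by the polarization of P. By
  -- `polar` and injectivity of gᵀ, its image under h is killed too, hence proportional to it.
  have hker : pfaffianPolar (h 1) (h 1) - (2 : ℝ) • pfaffianPolar (h 0) (h 2) = 0 := by
    apply hginv
    have e : ∀ i : Fin 3, h i = Pi.single i 1 ᵥ* h := fun i => (single_one_vecMul i h).symm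
    rw [mulVec_sub, mulVec_smul, e 0, e 1, e 2, polar, polar]
    funext i
    fin_cases i <;> simp [pfaffianPolar]
  obtain ⟨c, hc⟩ : ∃ c : ℝ, hᵀ * q * h = c • q := by
    -- The (1, 1) entry of hᵀ q h; the matching entry of `q` is 1.
    refine ⟨h 1 1 * h 1 1 - 2 * h 0 1 * h 2 1, ?_⟩
    have h0 := congrFun hker 0
    have h1 := congrFun hker 1
    have h2 := congrFun hker 2
    have h3 := congrFun hker 3
    have h4 := congrFun hker 4
    simp [pfaffianPolar] at h0 h1 h2 h3 h4
    ext i j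
    fin_cases i <;> fin_cases j <;> simp [q, Matrix.mul_apply, Fin.sum_univ_three] <;> linarith
  -- If xh = 0 then P(x) = gᵀ P(0) = 0, which forces x = 0.
  have hdet0 : h.det ≠ 0 := by
    intro h0
    obtain ⟨x, hx, hx0⟩ := exists_vecMul_eq_zero_iff.2 h0
    apply hx
    apply pfaffianPolar_self_eq_zero
    rw [← diag, hx0]
    have : pfaffianPolar 0 0 = 0 := by
      funext i; fin_cases i <;> simp [pfaffianPolar]
    rw [this, mulVec_zero]
  have hdet : h.det ^ 2 = c ^ 3 := by
    have := congrArg det hc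
    rw [det_mul, det_mul, det_transpose, det_smul, hqdet, Fintype.card_fin] at this
    linarith
  have hc0 : 0 < c := by
    have : 0 < c ^ 3 := hdet ▸ (by positivity)
    by_contra hneg
    push Not at hneg
    have := (show Odd 3 by decide).pow_nonpos hneg
    linarith
  -- From hᵀ q h = cq and q² = 1, the inverse of h is c⁻¹ q hᵀ q. The transposed relation is the one
  -- that applies to row vectors multiplied by h on the right.
  have hcq : h * q * hᵀ = c • q := by
    have h1 : (c⁻¹ • (q * hᵀ * q)) * h = 1 := by
      rw [smul_mul_assoc, Matrix.mul_assoc, Matrix.mul_assoc, ← Matrix.mul_assoc hᵀ, hc,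
        mul_smul_comm, hqq, smul_smul, inv_mul_cancel₀ hc0.ne', one_smul]
    have h2 := congrArg (· * q) (mul_eq_one_comm.1 h1)
    simp only [mul_smul_comm, smul_mul_assoc, Matrix.one_mul] at h2
    rw [← Matrix.mul_assoc, ← Matrix.mul_assoc, Matrix.mul_assoc (h * q * hᵀ), hqq,
      Matrix.mul_one] at h2
    conv_rhs => rw [← h2]
    rw [smul_smul, mul_inv_cancel₀ hc0.ne', one_smul]
  have hform : ∀ x y : Fin 3 → ℝ, (x ᵥ* h) ⬝ᵥ (q *ᵥ (y ᵥ* h)) = c * (x ⬝ᵥ (q *ᵥ y)) := by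
    intro x y
    rw [← mulVec_transpose h y, ← dotProduct_mulVec, mulVec_mulVec, mulVec_mulVec,
      hcq, smul_mulVec, dotProduct_smul, smul_eq_mul]
  -- the multiplier of `h` is one
  let N : Matrix (Fin 5) (Fin 5) ℝ :=
    !![0, 0, 0, 0, 3; 0, 0, 0, -6, 0; 0, 0, 2, 0, 0; 0, -6, 0, 0, 0; 3, 0, 0, 0, 0]
  -- The coefficient 3 is the dimension: it makes the right side, polarized in x, vanish on e₁² −
  -- 2e₀e₂, so that it depends on x and y only through P(x) and P(y).
  have hN : ∀ x y, pfaffianPolar x x ⬝ᵥ (N *ᵥ pfaffianPolar y y) =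
      3 * (x ⬝ᵥ (q *ᵥ y)) ^ 2 - (x ⬝ᵥ (q *ᵥ x)) * (y ⬝ᵥ (q *ᵥ y)) := by
    intro x y
    simp [N, q, pfaffianPolar, dotProduct, mulVec, Fin.sum_univ_five, Fin.sum_univ_three]
    ring
  have hNdet : N.det ≠ 0 := by
    let N' : Matrix (Fin 5) (Fin 5) ℝ := !![0, 0, 0, 0, 1 / 3; 0, 0, 0, -(1 / 6), 0;
      0, 0, 1 / 2, 0, 0; 0, -(1 / 6), 0, 0, 0; 1 / 3, 0, 0, 0, 0]
    have : N * N' = 1 := by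
      ext i j
      fin_cases i <;> fin_cases j <;> simp [N, N', Matrix.mul_apply, Fin.sum_univ_five]
    exact left_ne_zero_of_mul_eq_one (by rw [← det_mul, this, det_one])
  have hsurj : ∀ u : Fin 3 → ℝ, ∃ x, x ᵥ* h = u := fun u =>
    ⟨u ᵥ* h⁻¹, by rw [vecMul_vecMul, nonsing_inv_mul _ (isUnit_iff_ne_zero.2 hdet0), vecMul_one]⟩
  -- Both sides agree on all pairs P(xh), P(yh): the form `hN` is of degree two in `q`, hence scaled
  -- by c² under h. As h is invertible, such vectors span ℝ⁵.
  have hinv : N = c ^ 2 • (g * N * gᵀ) := by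
    rw [← sub_eq_zero]
    have hM : ∀ u v, pfaffianPolar u u ⬝ᵥ
        ((N - c ^ 2 • (g * N * gᵀ)) *ᵥ pfaffianPolar v v) = 0 := by
      intro u v
      obtain ⟨x, rfl⟩ := hsurj u
      obtain ⟨y, rfl⟩ := hsurj v
      have h1 := hN (x ᵥ* h) (y ᵥ* h)
      have h2 := hN x y
      rw [← diag x, ← diag y, mulVec_transpose, ← dotProduct_mulVec, mulVec_mulVec,
        mulVec_mulVec] at h2
      rw [hform, hform, hform] at h1
      rw [sub_mulVec, dotProduct_sub, smul_mulVec, dotProduct_smul, h1, h2,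
        smul_eq_mul]
      ring
    have hM' : ∀ v, (N - c ^ 2 • (g * N * gᵀ)) *ᵥ pfaffianPolar v v = 0 := fun v =>
      eq_zero_of_forall_pfaffianPolar_dotProduct fun u => hM u v
    ext i j
    have := eq_zero_of_forall_pfaffianPolar_dotProduct
      (m := fun j => (N - c ^ 2 • (g * N * gᵀ)) i j) fun v => by
        rw [dotProduct_comm]
        exact congrFun (hM' v) i
    exact congrFun this j
  -- In dimension five the factor c² contributes c¹⁰ to the determinant.
  have hc1 : c = 1 := by
    have := congrArg det hinv
    rw [det_smul, det_mul, det_mul, det_transpose, hg, Fintype.card_fin, one_mul, mul_one,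
      right_eq_mul₀ hNdet, ← pow_mul] at this
    exact (pow_eq_one_iff_of_nonneg hc0.le (by norm_num)).1 this
  -- a vector fixed by `h` up to sign gives a vector fixed by `gᵀ`
  have hs : (h - h.det • (1 : Matrix (Fin 3) (Fin 3) ℝ)).det = 0 := by
    rw [hc1, one_pow] at hdet
    rw [hc1, one_smul] at hc
    -- With d = det h = ±1, taking determinants gives −d·det(h − d) = d³·det(h − d): the signs
    -- disagree because the dimension is odd, so det(h − d) = 0.
    have e : hᵀ * q * (h - h.det • 1) = h.det • ((h.det • 1 - h)ᵀ * q) := by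
      rw [mul_sub, hc, transpose_sub, transpose_smul, transpose_one, sub_mul, smul_sub,
        mul_smul_comm, smul_mul_assoc, smul_smul, ← pow_two, hdet, one_smul, Matrix.mul_one,
        Matrix.one_mul]
    have e' := congrArg det e
    rw [det_mul, det_mul, det_transpose, det_smul, det_mul, det_transpose, hqdet,
      ← neg_sub h, det_neg, Fintype.card_fin] at e'
    have h3 : h.det ^ 3 = h.det := by rw [pow_succ, hdet, one_mul]
    rw [h3] at e'
    have : h.det * (h - h.det • (1 : Matrix (Fin 3) (Fin 3) ℝ)).det = 0 := by linarith
    exact (mul_eq_zero.1 this).resolve_left hdet0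
  obtain ⟨x, hx0, hx⟩ := exists_vecMul_eq_zero_iff.2 hs
  rw [vecMul_sub, vecMul_smul, vecMul_one, sub_eq_zero] at hx
  have hfix : gᵀ *ᵥ pfaffianPolar x x = pfaffianPolar x x := by
    have h1 := diag x
    have h2 : pfaffianPolar (h.det • x) (h.det • x) = h.det ^ 2 • pfaffianPolar x x := by
      funext i
      fin_cases i <;> simp [pfaffianPolar] <;> ring
    rwa [hx, h2, hdet, hc1, one_pow, one_smul] at h1
  rw [← det_transpose, ← exists_mulVec_eq_zero_iff]
  refine ⟨pfaffianPolar x x, fun h0 => hx0 (pfaffianPolar_self_eq_zero h0), ?_⟩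
  rw [transpose_sub, transpose_one, sub_mulVec, one_mulVec, hfix, sub_self]

end MatrixPencil

/-! ### Two-forms and the action of automorphisms on commutators -/

section Factor

variable {V : Type} [AddCommGroup V] [Module ℝ V] {W : Submodule ℝ (⋀[ℝ]^2 V)}

/-- The two-form `α ∧ β`, as a linear form on `⋀² V`. -/
def wedgeForm (α β : V →ₗ[ℝ] ℝ) : ⋀[ℝ]^2 V →ₗ[ℝ] ℝ :=
  exteriorPower.alternatingMapLinearEquiv
    ((Matrix.detRowAlternating (R := ℝ) (n := Fin 2)).compLinearMap (LinearMap.pi ![α, β]))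

lemma wedgeForm_wedge (α β : V →ₗ[ℝ] ℝ) (v w : V) :
    wedgeForm α β (wedge v w) = α v * β w - β v * α w := by
  rw [wedgeForm, wedge_apply, exteriorPower.alternatingMapLinearEquiv_apply_ιMulti,
    AlternatingMap.compLinearMap_apply]
  change Matrix.det (Matrix.of fun i => LinearMap.pi ![α, β] (![v, w] i)) = _
  rw [Matrix.det_fin_two]
  simp

variable [Module.Finite ℝ V]

lemma factor_log_fst (τ : NilGroup W ≃ₜ* NilGroup W) (x : NilGroup W) :
    factor τ (log x).1 = (log (τ x)).1 := factor_proj τ x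

open scoped commutatorElement in
/-- The factor of an automorphism preserves the relations between commutators. -/
lemma mkQ_wedge_factor (τ : NilGroup W ≃ₜ* NilGroup W) {a b c d : V}
    (h : W.mkQ (wedge a b) = W.mkQ (wedge c d)) :
    W.mkQ (wedge (factor τ a) (factor τ b)) = W.mkQ (wedge (factor τ c) (factor τ d)) := by
  -- The class of a ∧ b modulo W is the logarithm of the commutator of lifts of a and b, so the
  -- hypothesis is an equality of commutators in the group, preserved by τ.
  let e : V → NilGroup W := fun v => exp ((v, 0) : V × ((⋀[ℝ]^2 V) ⧸ W))
  have he : ⁅e a, e b⁆ = ⁅e c, e d⁆ := by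
    apply log.injective
    rw [log_commutatorElement, log_commutatorElement, lie_def, lie_def, bracket_apply,
      bracket_apply]
    exact congrArg (Prod.mk 0) h
  have hτ : ⁅log (τ (e a)), log (τ (e b))⁆ = ⁅log (τ (e c)), log (τ (e d))⁆ := by
    rw [← log_commutatorElement, ← log_commutatorElement, ← map_commutatorElement,
      ← map_commutatorElement, he]
  have := congrArg Prod.snd hτ
  simp only [lie_def, bracket_apply, ← factor_log_fst] at this
  exact this

lemma factor_trans (τ τ' : NilGroup W ≃ₜ* NilGroup W) :
    factor (τ.trans τ') = factor τ' ∘ₗ factor τ := by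
  ext v
  obtain ⟨x, hx⟩ := proj_surjective W (Multiplicative.ofAdd v)
  have hx' : v = (proj W x).toAdd := by rw [hx]; rfl
  rw [LinearMap.comp_apply, hx', factor_proj, factor_proj, factor_proj]
  rfl

end Factor

/-! ### From automorphisms of G to the matrix pencil -/

section Coordinates

/-- The coordinates in the basis `σ₁, …, σ₅`. -/
def sigmaEquiv : V ≃ₗ[ℝ] (Fin 5 → ℝ) where
  toFun v := ![v.1 0 0 / 2, v.1 0 1, v.1 0 2, v.1 1 2, v.1 2 2 / 2]
  map_add' v w := by
    funext i
    fin_cases i <;> simp [add_div]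
  map_smul' c v := by
    funext i
    fin_cases i <;> simp [mul_div_assoc]
  invFun c := c 0 • σ₁ + c 1 • σ₂ + c 2 • σ₃ + c 3 • σ₄ + c 4 • σ₅
  left_inv v := by
    obtain ⟨v, hs, ht⟩ := v
    have h := fun i j => hs.apply i j
    apply Subtype.ext
    have h10 := h 0 1
    have h20 := h 0 2
    have h21 := h 1 2
    ext i j
    fin_cases i <;> fin_cases j <;>
      simp [σ₁, σ₂, σ₃, σ₄, σ₅, h10, h20, h21, ht, mul_two]
  right_inv c := by
    funext i
    fin_cases i <;> simp [σ₁, σ₂, σ₃, σ₄, σ₅]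

/-- The basis `σ₁, …, σ₅` of `V`. -/
def sigmaBasis : Module.Basis (Fin 5) ℝ V := Module.Basis.ofEquivFun sigmaEquiv

/-- The skew matrix of a bivector in the basis `σ₁, …, σ₅`. -/
def bivectorMatrix : ⋀[ℝ]^2 V →ₗ[ℝ] Matrix (Fin 5) (Fin 5) ℝ :=
  LinearMap.pi fun i => LinearMap.pi fun j => wedgeForm (sigmaBasis.coord i) (sigmaBasis.coord j)

open Matrix

lemma bivectorMatrix_wedge (v w : V) : bivectorMatrix (wedge v w) =
    vecMulVec (sigmaEquiv v) (sigmaEquiv w) - vecMulVec (sigmaEquiv w) (sigmaEquiv v) := by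
  ext i j
  change wedgeForm _ _ _ = _
  rw [wedgeForm_wedge]
  simp only [Matrix.sub_apply, vecMulVec_apply]
  change sigmaEquiv v i * sigmaEquiv w j - sigmaEquiv v j * sigmaEquiv w i = _
  ring

lemma sigmaEquiv_sigma : sigmaEquiv σ₁ = ![1, 0, 0, 0, 0] ∧ sigmaEquiv σ₂ = ![0, 1, 0, 0, 0] ∧
    sigmaEquiv σ₃ = ![0, 0, 1, 0, 0] ∧ sigmaEquiv σ₄ = ![0, 0, 0, 1, 0] ∧
    sigmaEquiv σ₅ = ![0, 0, 0, 0, 1] := by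
  refine ⟨?_, ?_, ?_, ?_, ?_⟩ <;>
  · funext i
    fin_cases i <;> simp [sigmaEquiv, σ₁, σ₂, σ₃, σ₄, σ₅]

/-- The generators of `W`. -/
def generatorW : Fin 3 → ⋀[ℝ]^2 V :=
  ![wedge σ₁ σ₄ - wedge σ₂ σ₃, wedge σ₁ σ₅ - wedge σ₂ σ₄, wedge σ₂ σ₅ - wedge σ₃ σ₄]

lemma bivectorMatrix_generatorW (i : Fin 3) :
    bivectorMatrix (generatorW i) = skewPencil (Pi.single i 1) := by
  obtain ⟨h1, h2, h3, h4, h5⟩ := sigmaEquiv_sigma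
  fin_cases i <;>
  · simp only [generatorW, map_sub, bivectorMatrix_wedge, h1, h2, h3, h4, h5, Fin.zero_eta,
      Fin.mk_one, Fin.reduceFinMk, Matrix.cons_val]
    ext i j
    fin_cases i <;> fin_cases j <;> simp [skewPencil]

lemma skewPencil_add (x y : Fin 3 → ℝ) :
    skewPencil (x + y) = skewPencil x + skewPencil y := by
  ext i j
  fin_cases i <;> fin_cases j <;> simp [skewPencil] <;> ring

lemma skewPencil_smul (c : ℝ) (x : Fin 3 → ℝ) : skewPencil (c • x) = c • skewPencil x := by
  ext i j
  fin_cases i <;> fin_cases j <;> simp [skewPencil]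

lemma exists_bivectorMatrix_eq_of_mem {u : ⋀[ℝ]^2 V} (hu : u ∈ W) :
    ∃ x, bivectorMatrix u = skewPencil x := by
  obtain ⟨a, b, c, rfl⟩ := Submodule.mem_span_triple.1 hu
  refine ⟨a • Pi.single 0 1 + b • Pi.single 1 1 + c • Pi.single 2 1, ?_⟩
  simp only [skewPencil_add, skewPencil_smul, ← bivectorMatrix_generatorW, map_add, map_smul]
  rfl

/-- An endomorphism of `V` acts on skew matrices by congruence. -/
lemma bivectorMatrix_wedge_map (f : V →ₗ[ℝ] V) (v w : V) :
    bivectorMatrix (wedge (f v) (f w)) = LinearMap.toMatrix sigmaBasis sigmaBasis f *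
      bivectorMatrix (wedge v w) * (LinearMap.toMatrix sigmaBasis sigmaBasis f)ᵀ := by
  have h : ∀ v, sigmaEquiv (f v) =
      LinearMap.toMatrix sigmaBasis sigmaBasis f *ᵥ sigmaEquiv v := fun v =>
    (LinearMap.toMatrix_mulVec_repr sigmaBasis sigmaBasis f v).symm
  rw [bivectorMatrix_wedge, bivectorMatrix_wedge, h, h, Matrix.mul_sub, Matrix.sub_mul,
    mul_vecMulVec, mul_vecMulVec, vecMulVec_mul, vecMulVec_mul, vecMul_transpose,
    vecMul_transpose]

/-- A continuous automorphism of `G` whose factor has determinant one fixes a nonzero vector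
of `G/[G, G]`. -/
theorem exists_factor_apply_eq (τ : G ≃ₜ* G) (hτ : LinearMap.det (factor τ) = 1) :
    ∃ v : V, v ≠ 0 ∧ factor τ v = v := by
  set g := LinearMap.toMatrix sigmaBasis sigmaBasis (factor τ) with hg
  have hdet : g.det = 1 := by rw [hg, LinearMap.det_toMatrix, hτ]
  -- Every generator of W is a difference of two decomposable bivectors, so its membership in W is
  -- an equality of two commutators. This avoids the induced action on all of ⋀² V.
  have mem : ∀ a b c d : V, wedge a b - wedge c d ∈ W →
      ∃ y, g * bivectorMatrix (wedge a b - wedge c d) * gᵀ = skewPencil y := by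
    intro a b c d h
    have h1 : W.mkQ (wedge a b) = W.mkQ (wedge c d) :=
      (Submodule.Quotient.eq W).2 h
    have h2 := (Submodule.Quotient.eq W).1 (mkQ_wedge_factor τ h1)
    obtain ⟨y, hy⟩ := exists_bivectorMatrix_eq_of_mem h2
    refine ⟨y, ?_⟩
    rw [← hy, map_sub, map_sub, bivectorMatrix_wedge_map, bivectorMatrix_wedge_map, Matrix.mul_sub,
      Matrix.sub_mul]
  have hgen : ∀ i : Fin 3, ∃ y, g * skewPencil (Pi.single i 1) * gᵀ = skewPencil y := by
    intro i
    rw [← bivectorMatrix_generatorW]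
    fin_cases i
    · exact mem _ _ _ _ (Submodule.subset_span (by simp))
    · exact mem _ _ _ _ (Submodule.subset_span (by simp))
    · exact mem _ _ _ _ (Submodule.subset_span (by simp))
  -- Row i of `h` holds the pencil coordinates of the image of generator i.
  choose h hh using hgen
  have key : ∀ x, g * skewPencil x * gᵀ = skewPencil (x ᵥ* Matrix.of h) := by
    intro x
    have e : x = x 0 • Pi.single 0 1 + x 1 • Pi.single 1 1 + x 2 • Pi.single 2 1 := by
      funext i
      fin_cases i <;> simp
    have e' : x ᵥ* Matrix.of h = x 0 • h 0 + x 1 • h 1 + x 2 • h 2 := by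
      funext i
      simp [vecMul, dotProduct, Fin.sum_univ_three]
    rw [e', skewPencil_add, skewPencil_add, skewPencil_smul, skewPencil_smul, skewPencil_smul,
      ← hh, ← hh, ← hh]
    conv_lhs => rw [e]
    simp only [skewPencil_add, skewPencil_smul, Matrix.mul_add, Matrix.add_mul,
      mul_smul_comm, smul_mul_assoc]
  obtain ⟨c, hc0, hc⟩ := exists_mulVec_eq_zero_iff.2 (det_sub_one_eq_zero_of_skewPencil hdet key)
  rw [sub_mulVec, one_mulVec, sub_eq_zero] at hc
  refine ⟨sigmaEquiv.symm c, by simpa using hc0, sigmaEquiv.injective ?_⟩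
  have := LinearMap.toMatrix_mulVec_repr sigmaBasis sigmaBasis (factor τ) (sigmaEquiv.symm c)
  have e : ⇑(sigmaBasis.repr (sigmaEquiv.symm c)) = c := sigmaEquiv.apply_symm_apply c
  rw [e, ← hg, hc] at this
  rw [LinearEquiv.apply_symm_apply]
  exact this.symm

end Coordinates

/-! ### Endomorphisms preserving a lattice -/

section IntegerMatrix

open Module Matrix

variable {E : Type*} [NormedAddCommGroup E] [NormedSpace ℝ E] [FiniteDimensional ℝ E]
  {L : Submodule ℤ E} [DiscreteTopology L] [IsZLattice ℝ L]

/-- An endomorphism which preserves a lattice has an integer matrix. -/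
lemma exists_intMatrix {ι : Type*} [Fintype ι] [DecidableEq ι] (b : Basis ι ℤ L)
    (T : E →ₗ[ℝ] E) (hT : ∀ x ∈ L, T x ∈ L) :
    ∃ M : Matrix ι ι ℤ, LinearMap.toMatrix (b.ofZLatticeBasis ℝ L) (b.ofZLatticeBasis ℝ L) T =
      M.map (Int.castRingHom ℝ) := by
  refine ⟨Matrix.of fun i j => b.repr ⟨T (b j), hT _ (b j).2⟩ i, ?_⟩
  ext i j
  rw [LinearMap.toMatrix_apply, Basis.ofZLatticeBasis_apply]
  exact Basis.ofZLatticeBasis_repr_apply ℝ L b ⟨T (b j), hT _ (b j).2⟩ i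

/-- In a basis of the lattice both maps have integer matrices, so their determinants are integers
with product 1. -/
lemma det_sq_eq_one_of_preserves {T T' : E →ₗ[ℝ] E} (hT : ∀ x ∈ L, T x ∈ L)
    (hT' : ∀ x ∈ L, T' x ∈ L) (hTT' : T ∘ₗ T' = LinearMap.id) : LinearMap.det T ^ 2 = 1 := by
  have : Module.Free ℤ L := ZLattice.module_free ℝ L
  have : Module.Finite ℤ L := ZLattice.module_finite ℝ L
  let b := Free.chooseBasis ℤ L
  obtain ⟨M, hM⟩ := exists_intMatrix b T hT
  obtain ⟨M', hM'⟩ := exists_intMatrix b T' hT'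
  have h1 : LinearMap.det T = (M.det : ℝ) := by
    rw [← LinearMap.det_toMatrix (b.ofZLatticeBasis ℝ L), hM, ← RingHom.mapMatrix_apply,
      ← RingHom.map_det]
    rfl
  have h2 : LinearMap.det T' = (M'.det : ℝ) := by
    rw [← LinearMap.det_toMatrix (b.ofZLatticeBasis ℝ L), hM', ← RingHom.mapMatrix_apply,
      ← RingHom.map_det]
    rfl
  have h3 : M.det * M'.det = 1 := by
    have := congrArg LinearMap.det hTT'
    rw [LinearMap.det_comp, LinearMap.det_id, h1, h2] at this
    exact_mod_cast this
  have h4 : M.det ^ 2 = 1 := by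
    rcases Int.eq_one_or_neg_one_of_mul_eq_one h3 with h | h <;> rw [h] <;> norm_num
  rw [h1]
  exact_mod_cast h4

/-- An endomorphism which preserves a lattice and fixes a nonzero vector fixes a nonzero linear
form with integer values on the lattice. -/
lemma exists_fixed_integral_form {T : E →ₗ[ℝ] E} (hT : ∀ x ∈ L, T x ∈ L) {v : E} (hv : v ≠ 0)
    (hTv : T v = v) : ∃ χ : E →ₗ[ℝ] ℝ, χ ≠ 0 ∧ (∀ x ∈ L, ∃ n : ℤ, χ x = n) ∧
      ∀ x, χ (T x) = χ x := by
  have : Module.Free ℤ L := ZLattice.module_free ℝ L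
  have : Module.Finite ℤ L := ZLattice.module_finite ℝ L
  let b := Free.chooseBasis ℤ L
  let B := b.ofZLatticeBasis ℝ L
  obtain ⟨M, hM⟩ := exists_intMatrix b T hT
  have hmap : (M - 1).map (Int.castRingHom ℝ) = M.map (Int.castRingHom ℝ) - 1 := by
    rw [← RingHom.mapMatrix_apply, map_sub, map_one, RingHom.mapMatrix_apply]
  have hdet : (M - 1).det = 0 := by
    have h1 : ((M - 1).map (Int.castRingHom ℝ)).det = 0 := by
      rw [← exists_mulVec_eq_zero_iff]
      refine ⟨B.repr v, fun h => hv ?_, ?_⟩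
      · exact B.repr.map_eq_zero_iff.1 (DFunLike.coe_injective h)
      · rw [hmap, sub_mulVec, one_mulVec, ← hM, LinearMap.toMatrix_mulVec_repr, hTv, sub_self]
    rw [← RingHom.mapMatrix_apply, ← RingHom.map_det] at h1
    exact Int.cast_injective (h1.trans Int.cast_zero.symm)
  -- Singularity of M − 1 descends from ℝ to ℤ, so a left null vector can be chosen with integer
  -- entries; these are the coefficients of χ in the dual basis.
  obtain ⟨k, hk0, hk⟩ := exists_vecMul_eq_zero_iff.2 hdet
  rw [vecMul_sub, vecMul_one, sub_eq_zero] at hk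
  let k' : Free.ChooseBasisIndex ℤ L → ℝ := fun i => k i
  have hk' : k' ᵥ* M.map (Int.castRingHom ℝ) = k' := by
    funext j
    have := congrArg (Int.castRingHom ℝ) (congrFun hk j)
    rw [RingHom.map_vecMul] at this
    exact this
  let χ : E →ₗ[ℝ] ℝ := ∑ i, (k i : ℝ) • B.coord i
  have hχ : ∀ x, χ x = k' ⬝ᵥ B.repr x := fun x => by simp [χ, k', dotProduct]
  refine ⟨χ, fun h => hk0 ?_, fun x hx => ?_, fun x => ?_⟩
  · funext i
    have := LinearMap.congr_fun h (B i)
    rw [hχ] at this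
    simpa [k', Finsupp.single_eq_pi_single] using this
  · refine ⟨∑ i, k i * b.repr ⟨x, hx⟩ i, ?_⟩
    rw [hχ]
    have := fun i => Basis.ofZLatticeBasis_repr_apply ℝ L b ⟨x, hx⟩ i
    push_cast
    exact Finset.sum_congr rfl fun i _ => congrArg _ (this i)
  · rw [hχ, hχ, ← LinearMap.toMatrix_mulVec_repr B B T x, hM, dotProduct_mulVec, hk']

end IntegerMatrix

/-! ### The image of Γ in V is a lattice -/

section Lattice

variable {V : Type} [AddCommGroup V] [Module ℝ V] {W : Submodule ℝ (⋀[ℝ]^2 V)}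
  (Γ : Subgroup (NilGroup W))
  {E : Type*} [NormedAddCommGroup E] [NormedSpace ℝ E] (e : V ≃ₗ[ℝ] E)

variable (W) in
/-- The inclusion of `V` in the Lie algebra. -/
def inl : V →ₗ[ℝ] LieAlg W := LinearMap.inl ℝ V ((⋀[ℝ]^2 V) ⧸ W)

variable (W) in
/-- The inclusion of `(⋀² V)/W` in the Lie algebra. -/
def inr : (⋀[ℝ]^2 V) ⧸ W →ₗ[ℝ] LieAlg W := LinearMap.inr ℝ V ((⋀[ℝ]^2 V) ⧸ W)

lemma log_mul_exp_inr (x : NilGroup W) (z : (⋀[ℝ]^2 V) ⧸ W) :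
    log (x * exp (inr W z)) = log x + inr W z := by
  rw [log_mul, lie_def, bracket_apply]
  change log x + inr W z + (1 / 2 : ℝ) • inr W (W.mkQ (wedge (log x).1 (0 : V))) = _
  simp only [map_zero, smul_zero, add_zero]

lemma inl_fst_add_inr_snd (x : LieAlg W) : inl W x.1 + inr W x.2 = x :=
  Prod.ext (add_zero x.1) (zero_add x.2)

/-- The image of a subgroup of `G` in `G/[G, G] = V`, in linear coordinates. -/
def abelianImage : Submodule ℤ E :=
  AddSubgroup.toIntSubmodule
    { carrier := {x | ∃ γ ∈ Γ, e (log γ).1 = x}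
      zero_mem' := ⟨1, one_mem _, e.map_zero⟩
      add_mem' := by
        rintro _ _ ⟨γ, hγ, rfl⟩ ⟨δ, hδ, rfl⟩
        exact ⟨γ * δ, mul_mem hγ hδ,
          (congrArg e (congrArg Multiplicative.toAdd (map_mul (proj W) γ δ))).trans (map_add e _ _)⟩
      neg_mem' := by
        rintro _ ⟨γ, hγ, rfl⟩
        exact ⟨γ⁻¹, inv_mem hγ, map_neg e _⟩ }

lemma log_mul_fst (x y : NilGroup W) : (log (x * y)).1 = (log x).1 + (log y).1 :=
  congrArg Multiplicative.toAdd (map_mul (proj W) x y)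

variable [Module.Finite ℝ V]

lemma continuous_linear_log_fst {F : Type*} [NormedAddCommGroup F] [NormedSpace ℝ F]
    (f : V →ₗ[ℝ] F) : Continuous fun x : NilGroup W => f (log x).1 :=
  (f ∘ₗ LinearMap.fst ℝ V ((⋀[ℝ]^2 V) ⧸ W) : LieAlg W →ₗ[ℝ] F).continuous_of_finiteDimensional

/-- Otherwise a nonzero linear form vanishes on the image of Γ and descends to a continuous map from
the compact G/Γ onto ℝ. -/
lemma span_abelianImage [CompactSpace (NilGroup W ⧸ Γ)] :
    Submodule.span ℝ (abelianImage Γ e : Set E) = ⊤ := by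
  by_contra hne
  obtain ⟨f, hf0, hf⟩ := Submodule.exists_le_ker_of_lt_top _ (lt_top_iff_ne_top.2 hne)
  let φ : NilGroup W → ℝ := fun x => (f ∘ₗ e.toLinearMap) (log x).1
  have hφc : Continuous φ := continuous_linear_log_fst _
  have hφ : ∀ x y : NilGroup W, QuotientGroup.leftRel Γ x y → φ x = φ y := by
    intro x y hxy
    rw [QuotientGroup.leftRel_apply] at hxy
    have h1 : f (e (log (x⁻¹ * y)).1) = 0 := hf (Submodule.subset_span ⟨_, hxy, rfl⟩)
    have h2 : φ y = φ x + f (e (log (x⁻¹ * y)).1) := by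
      conv_lhs => rw [← mul_inv_cancel_left x y]
      simp only [φ, log_mul_fst x (x⁻¹ * y), map_add]
      rfl
    rw [h2, h1, add_zero]
  let ψ : NilGroup W ⧸ Γ → ℝ := Quotient.lift φ hφ
  have hψ : Continuous ψ := hφc.quotient_lift hφ
  have hsurj : Function.Surjective ψ := by
    intro r
    obtain ⟨y, rfl⟩ := LinearMap.surjective hf0 r
    refine ⟨QuotientGroup.mk (exp ((e.symm y, 0) : V × ((⋀[ℝ]^2 V) ⧸ W))), ?_⟩
    change f (e (e.symm y)) = _
    rw [LinearEquiv.apply_symm_apply]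
  have hc := isCompact_range hψ
  rw [hsurj.range_eq] at hc
  exact noncompact_univ ℝ hc

/-- The elements of `(⋀² V)/W` which lie in `Γ`. -/
def centralPart : Submodule ℤ ((⋀[ℝ]^2 V) ⧸ W) :=
  AddSubgroup.toIntSubmodule
    { carrier := {z | (exp (inr W z) : NilGroup W) ∈ Γ}
      zero_mem' := one_mem Γ
      add_mem' := by
        intro a b ha hb
        have h : exp (inr W (a + b)) = exp (inr W a) * exp (inr W b) :=
          log.injective ((map_add (inr W) a b).trans (log_mul_exp_inr (exp (inr W a)) b).symm)
        change exp (inr W (a + b)) ∈ Γ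
        rw [h]
        exact Γ.mul_mem ha hb
      neg_mem' := by
        intro a ha
        have h : exp (inr W (-a)) = (exp (inr W a))⁻¹ := log.injective (map_neg (inr W) a)
        change exp (inr W (-a)) ∈ Γ
        rw [h]
        exact Γ.inv_mem ha }

-- Commutators of elements of Γ give the classes of γ̄ ∧ δ̄, where γ̄ and δ̄ run over the image of
-- Γ. That image spans V, so these classes span the quotient of ⋀² V.
open scoped commutatorElement in
lemma span_centralPart [CompactSpace (NilGroup W ⧸ Γ)] :
    Submodule.span ℝ (centralPart Γ : Set ((⋀[ℝ]^2 V) ⧸ W)) = ⊤ := by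
  let e : V ≃ₗ[ℝ] (Fin (Module.finrank ℝ V) → ℝ) := (Module.finBasis ℝ V).equivFun
  have hspan : Submodule.span ℝ {v : V | ∃ γ ∈ Γ, (log γ).1 = v} = ⊤ := by
    have h1 := congrArg (Submodule.map e.symm.toLinearMap) (span_abelianImage Γ e)
    rw [Submodule.map_span, Submodule.map_top, LinearEquiv.range] at h1
    rw [← h1]
    congr 1
    ext v
    constructor
    · rintro ⟨γ, hγ, rfl⟩
      exact ⟨_, ⟨γ, hγ, rfl⟩, e.symm_apply_apply _⟩
    · rintro ⟨_, ⟨γ, hγ, rfl⟩, rfl⟩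
      exact ⟨γ, hγ, (e.symm_apply_apply _).symm⟩
  have hw : ∀ v w : V, W.mkQ (wedge v w) ∈
      Submodule.span ℝ (centralPart Γ : Set ((⋀[ℝ]^2 V) ⧸ W)) := by
    intro v w
    have hv : v ∈ Submodule.span ℝ {v : V | ∃ γ ∈ Γ, (log γ).1 = v} := hspan ▸ trivial
    have hw : w ∈ Submodule.span ℝ {v : V | ∃ γ ∈ Γ, (log γ).1 = v} := hspan ▸ trivial
    induction hv, hw using Submodule.span_induction₂ with
    | mem_mem v w hv hw =>
      obtain ⟨γ, hγ, rfl⟩ := hv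
      obtain ⟨δ, hδ, rfl⟩ := hw
      apply Submodule.subset_span
      have h1 : ⁅γ, δ⁆ ∈ Γ := by
        rw [commutatorElement_def]
        exact mul_mem (mul_mem (mul_mem hγ hδ) (inv_mem hγ)) (inv_mem hδ)
      have h2 : ⁅γ, δ⁆ = exp (inr W (W.mkQ (wedge (log γ).1 (log δ).1))) :=
        log.injective (log_commutatorElement γ δ)
      rwa [h2] at h1
    | zero_left w _ => simp
    | zero_right v _ => simp
    | add_left a b c _ _ _ ha hb =>
      rw [map_add, LinearMap.add_apply, map_add]; exact add_mem ha hb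
    | add_right a b c _ _ _ ha hb => rw [map_add, map_add]; exact add_mem ha hb
    | smul_left r a b _ _ h =>
      rw [map_smul, LinearMap.smul_apply, map_smul]; exact Submodule.smul_mem _ _ h
    | smul_right r a b _ _ h => rw [map_smul, map_smul]; exact Submodule.smul_mem _ _ h
  rw [eq_top_iff, ← W.range_mkQ, LinearMap.range_eq_map, ← exteriorPower.ιMulti_span,
    Submodule.map_span, Submodule.span_le]
  rintro _ ⟨_, ⟨v, rfl⟩, rfl⟩
  have hv : ![v 0, v 1] = v := by ext i; fin_cases i <;> rfl
  have := hw (v 0) (v 1)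
  rwa [wedge_apply, hv] at this

/-- The centre is covered by bounded translates of the lattice of central elements of `Γ`. -/
lemma exists_norm_sub_centralPart_le [CompactSpace (NilGroup W ⧸ Γ)] :
    ∃ R : ℝ, ∀ z : (⋀[ℝ]^2 V) ⧸ W, ∃ s ∈ centralPart Γ,
      ‖inr W (z - s)‖ ≤ R := by
  obtain ⟨t, htS, hspan, hli⟩ := exists_linearIndependent ℝ (centralPart Γ : Set ((⋀[ℝ]^2 V) ⧸ W))
  rw [span_centralPart] at hspan
  let B : Module.Basis t ℝ ((⋀[ℝ]^2 V) ⧸ W) :=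
    Module.Basis.mk hli (by rw [Subtype.range_coe, hspan])
  have : Fintype t := @Fintype.ofFinite _ (Module.Finite.finite_basis B)
  -- The basis consists of elements of `centralPart Γ`; rounding coordinates down leaves fractional
  -- parts in [0, 1).
  refine ⟨∑ j, ‖inr W (B j)‖, fun z => ⟨∑ j, ⌊B.repr z j⌋ • B j, ?_, ?_⟩⟩
  · refine sum_mem fun j _ => Submodule.smul_mem _ _ ?_
    rw [Module.Basis.mk_apply]
    exact htS j.2
  · have h1 : z - ∑ j, ⌊B.repr z j⌋ • B j = ∑ j, Int.fract (B.repr z j) • B j := by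
      conv_lhs => enter [1]; rw [← B.sum_repr z]
      rw [← Finset.sum_sub_distrib]
      refine Finset.sum_congr rfl fun j _ => ?_
      rw [← Int.self_sub_floor, sub_smul, Int.cast_smul_eq_zsmul]
    rw [h1, map_sum]
    refine (norm_sum_le _ _).trans (Finset.sum_le_sum fun j _ => ?_)
    rw [map_smul, norm_smul, Real.norm_eq_abs, abs_of_nonneg (Int.fract_nonneg _)]
    exact mul_le_of_le_one_left (norm_nonneg _) (Int.fract_lt_one _).le

/-- A point of the image of norm less than 1 lifts to Γ; a central element of Γ corrects the lift so
that it lies in a fixed compact set. Γ is closed and discrete, so it has only finitely many points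
there. -/
lemma discreteTopology_abelianImage [CompactSpace (NilGroup W ⧸ Γ)] [DiscreteTopology Γ] :
    DiscreteTopology (abelianImage Γ e) := by
  obtain ⟨R, hR⟩ := exists_norm_sub_centralPart_le Γ
  have : FiniteDimensional ℝ E := e.finiteDimensional
  let j' : E →L[ℝ] LieAlg W := LinearMap.toContinuousLinearMap (inl W ∘ₗ e.symm.toLinearMap)
  have hfin : (Γ ∩ {x : NilGroup W | ‖log x‖ ≤ ‖j'‖ + R} : Set (NilGroup W)).Finite := by
    have hcl : IsClosed (Γ : Set (NilGroup W)) := Subgroup.isClosed_of_discrete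
    have hc : IsCompact {x : NilGroup W | ‖log x‖ ≤ ‖j'‖ + R} := by
      have : ProperSpace (LieAlg W) := FiniteDimensional.proper ℝ _
      have h := isCompact_closedBall (0 : LieAlg W) (‖j'‖ + R)
      have h' : Metric.closedBall (0 : LieAlg W) (‖j'‖ + R) = {x | ‖x‖ ≤ ‖j'‖ + R} :=
        Set.ext fun x => mem_closedBall_zero_iff
      rw [h'] at h
      exact h
    exact (hc.inter_left hcl).finite
      (IsDiscrete.mono ⟨inferInstance⟩ Set.inter_subset_left)
  have hfin' : {x : abelianImage Γ e | ‖(x : E)‖ < 1}.Finite := by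
    refine Set.Finite.of_finite_image ((hfin.image fun x => e (log x).1).subset ?_)
      Subtype.val_injective.injOn
    rintro _ ⟨⟨x, γ, hγ, rfl⟩, hx, rfl⟩
    obtain ⟨s, hs, hsR⟩ := hR (log γ).2
    refine ⟨γ * exp (inr W (-s)), ⟨mul_mem hγ (neg_mem hs), ?_⟩, ?_⟩
    · have h1 : log (γ * exp (inr W (-s))) = j' (e (log γ).1) + inr W ((log γ).2 - s) := by
        rw [log_mul_exp_inr, sub_eq_add_neg, map_add, ← add_assoc]
        conv_lhs => enter [1]; rw [← inl_fst_add_inr_snd (log γ)]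
        simp [j']
      rw [Set.mem_ofPred_eq, h1]
      refine (norm_add_le _ _).trans (add_le_add ((j'.le_opNorm _).trans ?_) hsR)
      exact mul_le_of_le_one_right (norm_nonneg _) (le_of_lt hx)
    · change e (log (γ * _)).1 = e (log γ).1
      rw [log_mul_fst]
      exact congrArg e (add_zero _)
  apply discreteTopology_of_isOpen_singleton_zero
  refine isOpen_singleton_of_finite_mem_nhds 0 ?_ hfin'
  refine (isOpen_lt (by fun_prop) continuous_const).mem_nhds ?_
  simp

lemma isZLattice_abelianImage [CompactSpace (NilGroup W ⧸ Γ)]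
    [DiscreteTopology (abelianImage Γ e)] :
    IsZLattice ℝ (abelianImage Γ e) := ⟨span_abelianImage Γ e⟩

variable {Γ}

lemma factor_mem_abelianImage {τ : NilGroup W ≃ₜ* NilGroup W}
    (hτ : τ '' (Γ : Set (NilGroup W)) = Γ) {x : E} (hx : x ∈ abelianImage Γ e) :
    e (factor τ (e.symm x)) ∈ abelianImage Γ e := by
  obtain ⟨γ, hγ, rfl⟩ := hx
  refine ⟨τ γ, ?_, ?_⟩
  · rw [← SetLike.mem_coe, ← hτ]
    exact Set.mem_image_of_mem τ hγ
  · rw [LinearEquiv.symm_apply_apply, factor_log_fst]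

lemma image_symm_eq {τ : NilGroup W ≃ₜ* NilGroup W} (hτ : τ '' (Γ : Set (NilGroup W)) = Γ) :
    τ.symm '' (Γ : Set (NilGroup W)) = Γ := by
  conv_lhs => rw [← hτ]
  rw [← Set.image_comp]
  convert Set.image_id _
  funext x
  exact τ.symm_apply_apply x

/-- The factor of an automorphism preserving a lattice is unimodular. -/
lemma det_factor_sq_eq_one [DiscreteTopology Γ] [CompactSpace (NilGroup W ⧸ Γ)]
    {τ : NilGroup W ≃ₜ* NilGroup W} (hτ : τ '' (Γ : Set (NilGroup W)) = Γ) :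
    LinearMap.det (factor τ) ^ 2 = 1 := by
  let e : V ≃ₗ[ℝ] (Fin (Module.finrank ℝ V) → ℝ) := (Module.finBasis ℝ V).equivFun
  have := discreteTopology_abelianImage Γ e
  have := isZLattice_abelianImage Γ e
  rw [← LinearMap.det_conj (factor τ) e]
  refine det_sq_eq_one_of_preserves (L := abelianImage Γ e)
    (T' := (e : V →ₗ[ℝ] _) ∘ₗ factor τ.symm ∘ₗ (e.symm : _ →ₗ[ℝ] V))
    (fun x hx => factor_mem_abelianImage e hτ hx)
    (fun x hx => factor_mem_abelianImage e (image_symm_eq hτ) hx) ?_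
  have h : ∀ v, factor τ (factor τ.symm v) = v := by
    intro v
    obtain ⟨x, hx⟩ := proj_surjective W (Multiplicative.ofAdd v)
    have hx' : v = (proj W x).toAdd := by rw [hx]; rfl
    rw [hx', factor_proj, factor_proj]
    congr 2
    exact τ.apply_symm_apply x
  refine LinearMap.ext fun x => ?_
  simp [h]

end Lattice

/-! ### Failure of ergodicity -/

section NotErgodic

variable {V : Type} [AddCommGroup V] [Module ℝ V] {W : Submodule ℝ (⋀[ℝ]^2 V)}
  [Module.Finite ℝ V] {Γ : Subgroup (NilGroup W)}

/-- By transitivity and compactness, finitely many translates of a nonempty open set cover G/Γ, so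
that set cannot be null. -/
lemma isOpenPosMeasure_of_smulInvariant [CompactSpace (NilGroup W ⧸ Γ)]
    (μ : Measure (NilGroup W ⧸ Γ)) [IsProbabilityMeasure μ]
    [SMulInvariantMeasure (NilGroup W) (NilGroup W ⧸ Γ) μ] : μ.IsOpenPosMeasure where
  open_pos _ hU hne := (measure_isOpen_pos_of_smulInvariant_of_compact_ne_zero (NilGroup W)
    isCompact_univ (by simp) hU hne).ne'

/-- A factor of an automorphism on `G/Γ` is not ergodic if the square of the induced map on
`G/[G, G]` fixes a nonzero vector. -/
theorem not_ergodic_quotientMap [DiscreteTopology Γ] [CompactSpace (NilGroup W ⧸ Γ)]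
    {τ : NilGroup W ≃ₜ* NilGroup W} (hτ : τ '' (Γ : Set (NilGroup W)) = Γ) {v : V} (hv : v ≠ 0)
    (hτv : factor τ (factor τ v) = v) (μ : Measure (NilGroup W ⧸ Γ)) [IsProbabilityMeasure μ]
    [SMulInvariantMeasure (NilGroup W) (NilGroup W ⧸ Γ) μ] :
    ¬ Ergodic (quotientMap τ hτ) μ := by
  intro herg
  let e : V ≃ₗ[ℝ] (Fin (Module.finrank ℝ V) → ℝ) := (Module.finBasis ℝ V).equivFun
  have := discreteTopology_abelianImage Γ e
  have := isZLattice_abelianImage Γ e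
  let T := e.toLinearMap ∘ₗ factor τ ∘ₗ factor τ ∘ₗ e.symm.toLinearMap
  have hT : ∀ x ∈ abelianImage Γ e, T x ∈ abelianImage Γ e := by
    intro x hx
    have h1 := factor_mem_abelianImage e hτ (factor_mem_abelianImage e hτ hx)
    rwa [LinearEquiv.symm_apply_apply] at h1
  obtain ⟨χ, hχ0, hχΓ, hχT⟩ := exists_fixed_integral_form hT (v := e v) (by simpa using hv)
    (by simp [T, hτv])
  let ψ : V →ₗ[ℝ] ℝ := χ ∘ₗ e.toLinearMap
  have hψΓ : ∀ γ ∈ Γ, ∃ n : ℤ, ψ (log γ).1 = n := fun γ hγ => hχΓ _ ⟨γ, hγ, rfl⟩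
  have hψT : ∀ w, ψ (factor τ (factor τ w)) = ψ w := by
    intro w
    have := hχT (e w)
    simpa [T, ψ] using this
  have hper : ∀ x γ : NilGroup W, γ ∈ Γ →
      Real.cos (2 * Real.pi * ψ (log (x * γ)).1) = Real.cos (2 * Real.pi * ψ (log x).1) := by
    intro x γ hγ
    obtain ⟨n, hn⟩ := hψΓ γ hγ
    rw [log_mul_fst, map_add, hn, mul_add, mul_comm _ (n : ℝ), Real.cos_add_int_mul_two_pi]
  -- Only the square of the factor is known to fix ψ, so the sum is taken over ψ and its pullback by
  -- τ; τ exchanges the two terms.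
  let F₀ : NilGroup W → ℝ := fun x =>
    Real.cos (2 * Real.pi * ψ (log x).1) + Real.cos (2 * Real.pi * ψ (log (τ x)).1)
  have hF₀c : Continuous F₀ := by
    have h1 := continuous_linear_log_fst (W := W) ψ
    have h2 := h1.comp τ.continuous
    exact (Real.continuous_cos.comp (continuous_const.mul h1)).add
      (Real.continuous_cos.comp (continuous_const.mul h2))
  have hF₀ : ∀ x y : NilGroup W, QuotientGroup.leftRel Γ x y → F₀ x = F₀ y := by
    intro x y hxy
    rw [QuotientGroup.leftRel_apply] at hxy
    have hxy' : τ (x⁻¹ * y) ∈ Γ := by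
      rw [← SetLike.mem_coe, ← hτ]
      exact Set.mem_image_of_mem τ hxy
    have h1 := hper x _ hxy
    have h2 := hper (τ x) _ hxy'
    rw [← map_mul, mul_inv_cancel_left] at h2
    rw [mul_inv_cancel_left] at h1
    simp only [F₀, h1, h2]
  let F : NilGroup W ⧸ Γ → ℝ := Quotient.lift F₀ hF₀
  have hF : Continuous F := hF₀c.quotient_lift hF₀
  have hFτ : F ∘ quotientMap τ hτ = F := by
    funext q
    obtain ⟨x, rfl⟩ := QuotientGroup.mk_surjective q
    change F₀ (τ x) = F₀ x
    simp only [F₀, ← factor_log_fst, hψT]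
    rw [add_comm]
  obtain ⟨c, hc⟩ := herg.toPreErgodic.ae_eq_const_of_ae_eq_comp hF.measurable hFτ
  have := isOpenPosMeasure_of_smulInvariant μ
  -- Continuity and positivity on open sets turn constancy almost everywhere into constancy
  -- everywhere.
  have hFc : F = Function.const _ c := (hF.ae_eq_iff_eq μ continuous_const).1 hc
  have hF₀c : ∀ x, F₀ x = c := fun x => congrFun hFc (QuotientGroup.mk x)
  have hc2 : c = 2 := by
    rw [← hF₀c 1]
    have h1 : (log (1 : NilGroup W)).1 = (0 : V) := rfl
    simp only [F₀, map_one, h1, map_zero, mul_zero, Real.cos_zero]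
    norm_num
  have hψ0 : ψ ≠ 0 := by
    intro h
    apply hχ0
    refine LinearMap.ext fun x => ?_
    simpa [ψ] using LinearMap.congr_fun h (e.symm x)
  -- Where ψ = 1/2 the first cosine is −1 and the sum is at most 0, while it equals 2 at the
  -- identity.
  obtain ⟨w, hw⟩ := LinearMap.surjective hψ0 (1 / 2)
  have h2 := hF₀c (exp (inl W w))
  have h3 : ψ (log (exp (inl W w))).1 = 1 / 2 := hw
  rw [hc2] at h2
  simp only [F₀, h3] at h2
  rw [show 2 * Real.pi * (1 / 2) = Real.pi by ring, Real.cos_pi] at h2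
  linarith [Real.cos_le_one (2 * Real.pi * ψ (log (τ (exp (inl W w)))).1)]

end NotErgodic

end TwoStep

/-! ### Hyperbolicity at a fixed point -/

/-- At a fixed point of an Anosov diffeomorphism the square of the derivative has no eigenvalue
one. -/
lemma IsAnosovDiffeomorph.eq_zero_of_mfderiv_mfderiv_eq {E : Type*} [NormedAddCommGroup E]
    [NormedSpace ℝ E] {H : Type*} [TopologicalSpace H] {I : ModelWithCorners ℝ E H}
    {M : Type*} [TopologicalSpace M] [ChartedSpace H M] [IsManifold I 1 M] {f : M → M}
    (hf : IsAnosovDiffeomorph I f) {x : M} (hx : f x = x) {D : E →L[ℝ] E}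
    (hD : D = mfderiv I I f x) {v : E} (hv : D (D v) = v) : v = 0 := by
  obtain ⟨⟨Φ, hΦ⟩, g, Es, Eu, C, r, -, hr0, hr1, hsplit⟩ := hf
  have hdiff : MDifferentiable I I f := hΦ ▸ Φ.contMDiff.mdifferentiable one_ne_zero
  -- All iterates fix x, so their derivatives there are regarded as endomorphisms of the model space
  -- E and become the powers of `D`.
  have hiter : ∀ n : ℕ, f^[n] x = x ∧ MDifferentiableAt I I f^[n] x ∧
      @Eq (E →L[ℝ] E) (mfderiv I I f^[n] x) (D ^ n) := by
    intro n
    induction n with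
    | zero => exact ⟨rfl, mdifferentiableAt_id, mfderiv_id⟩
    | succ n ih =>
      obtain ⟨h1, h2, h3⟩ := ih
      refine ⟨by rw [Function.iterate_succ_apply, hx, h1], ?_, ?_⟩
      · rw [Function.iterate_succ]
        exact h2.comp_of_eq x (hdiff x) hx
      · have h4 : @Eq (E →L[ℝ] E) (mfderiv I I f^[n] (f x)) (D ^ n) :=
          (mfderiv_congr_point hx).trans h3
        rw [Function.iterate_succ, pow_succ]
        exact (mfderiv_comp_of_eq h2 (hdiff x) hx).trans
          (congrArg₂ (fun a b : E →L[ℝ] E => a.comp b) h4 hD.symm)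
  let q : E → ℝ := fun a => √(g.inner x a a)
  have hq : ∀ y : M, y = x → ∀ a : E, √(g.inner y a a) = q a := by
    rintro y rfl a
    rfl
  have hq0 : ∀ a : E, q a ≤ 0 → a = 0 := by
    intro a ha
    by_contra hne
    exact absurd (Real.sqrt_pos.2 (g.pos x a hne)) (not_lt.2 ha)
  have hE : ∀ y : M, y = x → @Eq (Submodule ℝ E) (Es y) (Es x) ∧
      @Eq (Submodule ℝ E) (Eu y) (Eu x) := by
    rintro y rfl
    exact ⟨rfl, rfl⟩
  let S : Submodule ℝ E := Es x
  let U : Submodule ℝ E := Eu x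
  obtain ⟨hc, hs, hu, hsn, hun⟩ := hsplit x
  have hc' : IsCompl S U := hc
  have hS : ∀ a ∈ S, D a ∈ S := by
    intro a ha
    have h1 : Submodule.map (D : E →ₗ[ℝ] E) S = S := by
      rw [hD]
      exact hs.trans (hE _ hx).1
    exact h1.le (Submodule.mem_map_of_mem ha)
  have hU : ∀ a ∈ U, D a ∈ U := by
    intro a ha
    have h1 : Submodule.map (D : E →ₗ[ℝ] E) U = U := by
      rw [hD]
      exact hu.trans (hE _ hx).2
    exact h1.le (Submodule.mem_map_of_mem ha)
  have hpow : ∀ a, D (D a) = a → ∀ n : ℕ, (D ^ (2 * n)) a = a := by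
    intro a ha n
    induction n with
    | zero => rfl
    | succ n ih => rw [mul_add, mul_one, pow_add, mul_apply_eq_comp, pow_two,
        mul_apply_eq_comp, ha, ih]
  -- A vector fixed by D² has constant norm along even iterates, so the contraction estimate on S
  -- and the expansion estimate on U both reduce to this inequality.
  have hlim : ∀ t : ℝ, (∀ n : ℕ, t ≤ C * r ^ (2 * n) * t) → t ≤ 0 := by
    intro t ht
    have h1 : Filter.Tendsto (fun n : ℕ => C * r ^ (2 * n) * t) Filter.atTop (nhds 0) := by
      have h2 : Filter.Tendsto (fun n : ℕ => (r ^ 2) ^ n) Filter.atTop (nhds 0) :=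
        tendsto_pow_atTop_nhds_zero_of_lt_one (by positivity) (pow_lt_one₀ hr0.le hr1 two_ne_zero)
      have h3 := (h2.const_mul C).mul_const t
      simpa [pow_mul] using h3
    exact ge_of_tendsto' h1 ht
  have hSfix : ∀ a ∈ S, D (D a) = a → a = 0 := by
    intro a ha hDa
    apply hq0
    apply hlim
    intro n
    have h1 := hsn a ha (2 * n)
    obtain ⟨h2, -, h3⟩ := hiter (2 * n)
    have h4 : @Eq E (mfderiv I I f^[2 * n] x a) a :=
      (DFunLike.congr_fun h3 a).trans (hpow a hDa n)
    have h5 := hq _ h2 (mfderiv I I f^[2 * n] x a)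
    exact (congrArg q h4).symm.le.trans (h5.symm.le.trans h1)
  have hUfix : ∀ a ∈ U, D (D a) = a → a = 0 := by
    intro a ha hDa
    apply hq0
    apply hlim
    intro n
    have h1 := hun a ha (2 * n)
    obtain ⟨h2, -, h3⟩ := hiter (2 * n)
    have h4 : @Eq E (mfderiv I I f^[2 * n] x a) a :=
      (DFunLike.congr_fun h3 a).trans (hpow a hDa n)
    have h5 := hq _ h2 (mfderiv I I f^[2 * n] x a)
    have h6 := h5.trans (congrArg q h4)
    rw [h6] at h1
    exact h1
  obtain ⟨s, hsS, u, huU, rfl⟩ := Submodule.mem_sup.1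
    (show v ∈ S ⊔ U by rw [hc'.sup_eq_top]; trivial)
  rw [map_add, map_add] at hv
  -- One side lies in S and the other in U, so both vanish and each component of v is itself fixed
  -- by D².
  have h1 : D (D s) - s = u - D (D u) := by
    rw [sub_eq_sub_iff_add_eq_add, hv, add_comm]
  have h2 : D (D s) - s = 0 := Submodule.disjoint_def.1 hc'.disjoint _
    (S.sub_mem (hS _ (hS _ hsS)) hsS) (h1 ▸ U.sub_mem huU (hU _ (hU _ huU)))
  rw [h2, eq_comm, sub_eq_zero, eq_comm] at h1
  rw [hSfix s hsS (sub_eq_zero.1 h2), hUfix u huU h1, add_zero]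

namespace TwoStep

/-! ### The derivative of the factor at the base point -/

section NotAnosov

variable {V : Type} [AddCommGroup V] [Module ℝ V] {W : Submodule ℝ (⋀[ℝ]^2 V)}

/-- Right translation by `g` is the sum of a constant and this linear map. -/
def rightMulLinear (g : LieAlg W) : LieAlg W →ₗ[ℝ] LieAlg W :=
  LinearMap.id + (1 / 2 : ℝ) • (bracket W).flip g

lemma log_mul_eq_rightMulLinear (x y : NilGroup W) :
    log (x * y) = rightMulLinear (log y) (log x) + log y := by
  rw [log_mul, lie_def]
  simp only [rightMulLinear, LinearMap.add_apply, LinearMap.id_apply, LinearMap.smul_apply,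
    LinearMap.flip_apply]
  abel

lemma rightMulLinear_injective (g : LieAlg W) : Function.Injective (rightMulLinear g) := by
  rw [← LinearMap.ker_eq_bot, LinearMap.ker_eq_bot']
  intro X hX
  have h0 : X + (1 / 2 : ℝ) • bracket W X g = 0 := hX
  have h1 : X.1 = 0 := by
    have := congrArg Prod.fst h0
    change X.1 + (1 / 2 : ℝ) • (0 : V) = 0 at this
    rwa [smul_zero, add_zero] at this
  have h2 : bracket W X g = 0 := by
    rw [bracket_apply, h1, map_zero, LinearMap.zero_apply, map_zero]
    rfl
  rwa [h2, smul_zero, add_zero] at h0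

variable [Module.Finite ℝ V] {Γ : Subgroup (NilGroup W)}

open scoped commutatorElement in
/-- A continuous automorphism, in exponential coordinates. -/
def lieMap (τ : NilGroup W ≃ₜ* NilGroup W) : LieAlg W →ₗ[ℝ] LieAlg W where
  toFun X := log (τ (exp X))
  map_smul' c X := log_apply_smul τ c X
  map_add' X Y := by
    let A : LieAlg W → LieAlg W := fun X => log (τ (exp X))
    have hb : ∀ X Y, A ⁅X, Y⁆ = ⁅A X, A Y⁆ := by
      intro X Y
      have h : exp ⁅X, Y⁆ = ⁅(exp X : NilGroup W), exp Y⁆ :=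
        log.injective (log_commutatorElement (exp X) (exp Y)).symm
      simp only [A, h, map_commutatorElement, log_commutatorElement]
    have hs : A ((1 / 2 : ℝ) • ⁅X, Y⁆) = (1 / 2 : ℝ) • ⁅A X, A Y⁆ := by
      rw [← hb]
      exact log_apply_smul τ _ _
    -- The value at X + Y + ½[X, Y] is computed in two ways: as the image of exp X · exp Y, and of
    -- exp(X + Y) · exp(½[X, Y]), whose second factor is central. Comparison gives additivity.
    have h1 : A (X + Y + (1 / 2 : ℝ) • ⁅X, Y⁆) = A X + A Y + (1 / 2 : ℝ) • ⁅A X, A Y⁆ := by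
      have h : exp (X + Y + (1 / 2 : ℝ) • ⁅X, Y⁆) = (exp X : NilGroup W) * exp Y := rfl
      simp only [A, h, map_mul, log_mul]
    have h2 : A (X + Y + (1 / 2 : ℝ) • ⁅X, Y⁆) = A (X + Y) + (1 / 2 : ℝ) • ⁅A X, A Y⁆ := by
      have h : exp (X + Y + (1 / 2 : ℝ) • ⁅X, Y⁆) =
          (exp (X + Y) : NilGroup W) * exp ((1 / 2 : ℝ) • ⁅X, Y⁆) := by
        apply log.injective
        change _ = X + Y + (1 / 2 : ℝ) • ⁅X, Y⁆ + (1 / 2 : ℝ) • ⁅X + Y, (1 / 2 : ℝ) • ⁅X, Y⁆⁆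
        rw [lie_smul, lie_def W (X + Y), lie_def W X, bracket_bracket_right, smul_zero, smul_zero,
          add_zero]
        rfl
      have h' : A (X + Y + (1 / 2 : ℝ) • ⁅X, Y⁆) = A (X + Y) + A ((1 / 2 : ℝ) • ⁅X, Y⁆) +
          (1 / 2 : ℝ) • ⁅A (X + Y), A ((1 / 2 : ℝ) • ⁅X, Y⁆)⁆ := by
        simp only [A, h, map_mul, log_mul]
      rw [h', hs, lie_smul, lie_def W (A X), lie_def W (A (X + Y)), bracket_bracket_right, smul_zero,
        smul_zero, add_zero]
    exact add_right_cancel (h2.symm.trans h1)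

lemma lieMap_apply (τ : NilGroup W ≃ₜ* NilGroup W) (X : LieAlg W) :
    lieMap τ X = log (τ (exp X)) := rfl

/-- The eigenvalue 1 passes from the quotient V to the Lie algebra: otherwise A² − 1, for A =
`lieMap τ`, is bijective in finite dimension, so the map it induces on V is surjective, hence
injective. -/
lemma exists_lieMap_fixed {τ : NilGroup W ≃ₜ* NilGroup W} {v : V} (hv : v ≠ 0)
    (hτv : factor τ (factor τ v) = v) : ∃ X : LieAlg W, X ≠ 0 ∧ lieMap τ (lieMap τ X) = X := by
  by_contra! h
  have hinj : Function.Injective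
      (lieMap τ ∘ₗ lieMap τ - LinearMap.id : LieAlg W →ₗ[ℝ] LieAlg W) := by
    rw [← LinearMap.ker_eq_bot, LinearMap.ker_eq_bot']
    intro X hX
    by_contra hne
    exact h X hne (sub_eq_zero.1 hX)
  have hsurj := LinearMap.injective_iff_surjective.1 hinj
  have hsurj' : Function.Surjective
      (factor τ ∘ₗ factor τ - LinearMap.id : V →ₗ[ℝ] V) := by
    intro w
    obtain ⟨X, hX⟩ := hsurj (inl W w)
    refine ⟨X.1, ?_⟩
    have h1 : (lieMap τ (lieMap τ X)).1 - X.1 = w := congrArg Prod.fst hX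
    rw [lieMap_apply, lieMap_apply, ← factor_log_fst] at h1
    change factor τ (log (τ (exp X))).1 - X.1 = w at h1
    rw [← factor_log_fst] at h1
    exact h1
  have hinj' := LinearMap.injective_iff_surjective.2 hsurj'
  refine hv (hinj' ?_)
  simp only [LinearMap.sub_apply, LinearMap.comp_apply, LinearMap.id_apply, hτv, sub_self,
    map_zero]

/-- The derivative of the factor of `τ` on `G/Γ` at the base point is conjugate to `τ` in
exponential coordinates. -/
lemma exists_mfderiv_quotientMap [DiscreteTopology Γ] {τ : NilGroup W ≃ₜ* NilGroup W}
    (hτ : τ '' (Γ : Set (NilGroup W)) = Γ)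
    (hd : MDifferentiableAt 𝓘(ℝ, LieAlg W) 𝓘(ℝ, LieAlg W) (quotientMap τ hτ)
      (QuotientGroup.mk 1)) :
    ∃ (D : LieAlg W →L[ℝ] LieAlg W) (B : LieAlg W →ₗ[ℝ] LieAlg W), Function.Injective B ∧
      D = mfderiv 𝓘(ℝ, LieAlg W) 𝓘(ℝ, LieAlg W) (quotientMap τ hτ) (QuotientGroup.mk 1) ∧
      ∀ X, D (B X) = B (lieMap τ X) := by
  have hloc := isLocalHomeomorph_mk Γ
  let x₀ : NilGroup W ⧸ Γ := QuotientGroup.mk 1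
  have hx₀ : quotientMap τ hτ x₀ = x₀ := congrArg QuotientGroup.mk (map_one τ)
  -- The chart at the base point is a local inverse of the projection near this chosen
  -- representative, which lies in Γ but need not be 1.
  let g : NilGroup W := Quotient.out x₀
  have hg : QuotientGroup.mk g = x₀ := Quotient.out_eq x₀
  have hgΓ : g ∈ Γ := by
    have := QuotientGroup.eq.1 hg.symm
    simpa using this
  -- Right multiplication by δ⁻¹ ∈ Γ leaves cosets unchanged and brings τ(g) back to g, so u ↦
  -- τ(u)δ⁻¹ is the factor of τ read in the chart.
  let δ : NilGroup W := g⁻¹ * τ g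
  have hδ : δ ∈ Γ := by
    refine mul_mem (inv_mem hgΓ) ?_
    rw [← SetLike.mem_coe, ← hτ]
    exact Set.mem_image_of_mem τ hgΓ
  have hτg : τ g * δ⁻¹ = g := by simp [δ]
  let a := hloc.localInverseAt g
  have ha : ∀ z ∈ a.target, a (QuotientGroup.mk z) = z := by
    intro z hz
    have := a.right_inv hz
    rwa [hloc.localInverseAt_symm] at this
  have hga : g ∈ a.target := hloc.self_mem_localInverseAt_target
  let φ : LieAlg W → LieAlg W := fun u => log (τ (exp u) * δ⁻¹)
  let L : LieAlg W →L[ℝ] LieAlg W :=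
    LinearMap.toContinuousLinearMap (rightMulLinear (log δ⁻¹) ∘ₗ lieMap τ)
  have hφ : ∀ u, φ u = L u + log δ⁻¹ := fun u => log_mul_eq_rightMulLinear _ _
  have hφL : HasFDerivAt φ L (log g) := by
    have : φ = fun u => L u + log δ⁻¹ := funext hφ
    rw [this]
    exact L.hasFDerivAt.add_const _
  have hwritten : writtenInExtChartAt 𝓘(ℝ, LieAlg W) 𝓘(ℝ, LieAlg W) x₀ (quotientMap τ hτ)
      =ᶠ[nhds (log g)] φ := by
    have hcont : Continuous fun u : NilGroup W => τ u * δ⁻¹ :=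
      τ.continuous.mul continuous_const
    have hmem : ∀ᶠ u : NilGroup W in nhds g, τ u * δ⁻¹ ∈ a.target :=
      hcont.continuousAt.eventually_mem (by rw [hτg]; exact a.open_target.mem_nhds hga)
    -- The target chart sits at the image of x₀, equal to x₀ only propositionally; a variable point
    -- y allows substitution.
    have hchart : ∀ y : NilGroup W ⧸ Γ, y = x₀ → ∀ z : NilGroup W ⧸ Γ,
        extChartAt 𝓘(ℝ, LieAlg W) y z = log (a z) := by
      rintro y rfl z
      rfl
    have hsymm : ∀ u : LieAlg W, (extChartAt 𝓘(ℝ, LieAlg W) x₀).symm u =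
        QuotientGroup.mk (exp u) := fun u => congrFun (hloc.localInverseAt_symm g) (exp u)
    filter_upwards [hmem] with u hu
    simp only [writtenInExtChartAt, Function.comp_apply]
    rw [hchart _ hx₀, hsymm]
    change log (a (QuotientGroup.mk (τ (exp u)))) = log (τ (exp u) * δ⁻¹)
    have h1 : (QuotientGroup.mk (τ (exp u)) : NilGroup W ⧸ Γ) =
        QuotientGroup.mk (τ (exp u) * δ⁻¹) := by
      rw [QuotientGroup.eq, inv_mul_cancel_left]
      exact inv_mem hδ
    exact (congrArg (fun z => log (a z)) h1).trans (congrArg log (ha _ hu))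
  have hbase : extChartAt 𝓘(ℝ, LieAlg W) x₀ x₀ = log g := by
    change log (a x₀) = log g
    rw [← hg, ha g hga]
  refine ⟨L, rightMulLinear (log g), rightMulLinear_injective _, ?_, ?_⟩
  · have h1 := hd.mfderiv
    refine Eq.trans ?_ h1.symm
    change L = fderivWithin ℝ (writtenInExtChartAt 𝓘(ℝ, LieAlg W) 𝓘(ℝ, LieAlg W) x₀
      (quotientMap τ hτ)) (Set.range 𝓘(ℝ, LieAlg W)) (extChartAt 𝓘(ℝ, LieAlg W) x₀ x₀)
    rw [hbase, ModelWithCorners.range_eq_univ, fderivWithin_univ]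
    exact ((hφL.congr_of_eventuallyEq hwritten).fderiv).symm
  -- Right translation by g conjugates φ to τ. Both are affine in exponential coordinates, and
  -- comparing linear parts gives the relation with B, the linear part of this translation.
  · have hconj : ∀ u, φ (log (exp u * g)) = log (τ (exp u) * g) := by
      intro u
      change log (τ (exp u * g) * δ⁻¹) = _
      rw [map_mul τ, mul_assoc, hτg]
    have hR : ∀ u, L (rightMulLinear (log g) u) + (L (log g) + log δ⁻¹) =
        rightMulLinear (log g) (lieMap τ u) + log g := by
      intro u
      rw [← add_assoc, ← map_add, ← hφ]
      have := hconj u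
      rw [log_mul_eq_rightMulLinear, log_mul_eq_rightMulLinear] at this
      exact this
    have h0 := hR 0
    simp only [map_zero, zero_add] at h0
    intro X
    have := hR X
    rw [h0] at this
    exact add_right_cancel this

/-- A factor of an automorphism on `G/Γ` is not Anosov if the square of the induced map on
`G/[G, G]` fixes a nonzero vector. -/
theorem not_isAnosovDiffeomorph_quotientMap [DiscreteTopology Γ] {τ : NilGroup W ≃ₜ* NilGroup W}
    (hτ : τ '' (Γ : Set (NilGroup W)) = Γ) {v : V} (hv : v ≠ 0)
    (hτv : factor τ (factor τ v) = v) :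
    ¬ IsAnosovDiffeomorph 𝓘(ℝ, LieAlg W) (quotientMap τ hτ) := by
  intro h
  have hd : MDifferentiableAt 𝓘(ℝ, LieAlg W) 𝓘(ℝ, LieAlg W) (quotientMap τ hτ)
      (QuotientGroup.mk 1) := by
    obtain ⟨⟨Φ, hΦ⟩, -⟩ := h
    exact hΦ ▸ Φ.contMDiff.mdifferentiable one_ne_zero _
  obtain ⟨D, B, hB, hD, hDB⟩ := exists_mfderiv_quotientMap hτ hd
  obtain ⟨X, hX0, hX⟩ := exists_lieMap_fixed hv hτv
  have hfix : quotientMap τ hτ (QuotientGroup.mk 1) = QuotientGroup.mk 1 :=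
    congrArg (QuotientGroup.mk (s := Γ)) (map_one τ)
  apply hX0
  apply hB
  rw [map_zero]
  exact h.eq_zero_of_mfderiv_mfderiv_eq hfix hD
    (by rw [hDB, hDB, hX])

end NotAnosov

end TwoStep

end

theorem mainTheorem5 :
    (∀ τ : TwoStep.G ≃ₜ* TwoStep.G, LinearMap.det (TwoStep.factor τ) = 1 →
      ∃ v : TwoStep.V, v ≠ 0 ∧ TwoStep.factor τ v = v) ∧
    (∀ (Γ : Subgroup TwoStep.G) [DiscreteTopology Γ] [CompactSpace (TwoStep.G ⧸ Γ)]
      (τ : TwoStep.G ≃ₜ* TwoStep.G) (hτ : τ '' (Γ : Set TwoStep.G) = Γ),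
      ¬ IsAnosovDiffeomorph 𝓘(ℝ, TwoStep.LieAlg TwoStep.W) (TwoStep.quotientMap τ hτ) ∧
      ∀ (μ : Measure (TwoStep.G ⧸ Γ)) [IsProbabilityMeasure μ]
        [SMulInvariantMeasure TwoStep.G (TwoStep.G ⧸ Γ) μ],
        ¬ Ergodic (TwoStep.quotientMap τ hτ) μ) := by
  refine ⟨TwoStep.exists_factor_apply_eq, fun Γ _ _ τ hτ => ?_⟩
  -- The factor of τ may have determinant −1, so part (1) is applied to τ².
  have hdet : LinearMap.det (TwoStep.factor (τ.trans τ)) = 1 := by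
    rw [TwoStep.factor_trans, LinearMap.det_comp, ← pow_two, TwoStep.det_factor_sq_eq_one hτ]
  obtain ⟨v, hv0, hv⟩ := TwoStep.exists_factor_apply_eq (τ.trans τ) hdet
  rw [TwoStep.factor_trans] at hv
  exact ⟨TwoStep.not_isAnosovDiffeomorph_quotientMap hτ hv0 hv, fun μ _ _ =>
    TwoStep.not_ergodic_quotientMap hτ hv0 hv μ⟩
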